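/- Let $d\ge 2$. For $1\le j\le d$ let $C_j$ be the hyperbolic geodesic of the unit disk $\mathbb D$ joining $e^{\pi i(j-1)/d}$ to $e^{\pi i j/d}$, let $C_{-j}$ be its complex conjugate, and let $g_j$ be the Möbius automorphism of $\mathbb D$ given by reflection in $C_j$ followed by complex conjugation. Let $\Gamma_0=G_d=\langle g_1,\dots,g_d\rangle$ (a Fuchsian group uniformizing a $(d+1)$-times punctured sphere), acting on the unit circle $\mathbb S^1$, and let $R$ be the ideal polygon with vertices at the $2d$-th roots of unity and edges $C_{\pm 1},\dots,C_{\pm d}$, a fundamental domain of $G_d$ with side pairings $g_j^{\pm1}:C_{\pm j}\to C_{\mp j}$. The Bowen-Series map of an ideal polygon with side pairings is the map $\mathbb S^1\to\mathbb S^1$ that acts, on the half-open counter-clockwise arc $[P,P')$ subtended by each edge (with $P,P'$ consecutive vertices), as the pairing transformation of that edge. Let $A$ be the Bowen-Series map of $R$, and for $\gamma\in\Gamma_0$ let $A^\gamma$ be that of the fundamental domain $\gamma\cdot R$, whose edges are $\gamma(C_{\pm j})$ and whose side pairings are $\gamma g_j^{\pm1}\gamma^{-1}$. A measure of maximal entropy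 (MME) of a map is an invariant Borel probability measure whose measure-theoretic entropy equals the topological entropy of the map. The Hausdorff dimension of a Borel probability measure $\mu$ on $\mathbb S^1$ is $\mathrm{HD}(\mu)=\inf\{\mathrm{HD}(Y): Y\subset\mathbb S^1 \text{ Borel},\ \mu(Y)=1\}$. Then: 1. $A$ has a unique measure of maximal entropy $\nu$, and for every $\gamma\in\Gamma_0$ the measures $\nu$ and $\gamma_*\nu$ are mutually absolutely continuous. 2. For every $\gamma\in\Gamma_0$, the map $A^\gamma$ has a unique measure of maximal entropy. The measures of maximal entropy of the maps $A^\gamma$, $\gamma\in\Gamma_0$, are pairwise mutually absolutely continuous, and they all have the same Hausdorff dimension. -/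

import Mathlib

open MeasureTheory Filter Topology Real

noncomputable section

/-! ### Entropy, measures of maximal entropy, Hausdorff dimension of a measure -/

/-- The Shannon entropy `H_μ(ξ) = - ∑ i, μ(ξ = i) log μ(ξ = i)` of the finite partition of `X`
into the fibres of a labelling map `ξ : X → ι`. -/
def partitionEntropy {X ι : Type*} [MeasurableSpace X] [Fintype ι]
    (μ : Measure X) (ξ : X → ι) : ℝ :=
  ∑ i, Real.negMulLog (μ.real (ξ ⁻¹' {i}))

/-- The labelling of the join `ξ ∨ T⁻¹ ξ ∨ ⋯ ∨ T⁻⁽ⁿ⁻¹⁾ ξ`: the `ξ`-itinerary of length `n`. -/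
def itinerary {X ι : Type*} (T : X → X) (ξ : X → ι) (n : ℕ) : X → (Fin n → ι) :=
  fun x i => ξ (T^[i] x)

/-- The entropy `h_μ(T, ξ) = lim (1/n) H_μ(ξ ∨ T⁻¹ ξ ∨ ⋯ ∨ T⁻⁽ⁿ⁻¹⁾ ξ)` of `T` relative to a finite
partition `ξ` (the limit exists when `T` preserves `μ`, and is written as an upper limit). -/
def entropyOfPartition {X ι : Type*} [MeasurableSpace X] [Fintype ι]
    (T : X → X) (μ : Measure X) (ξ : X → ι) : EReal :=
  limsup (fun n : ℕ => ((partitionEntropy μ (itinerary T ξ n) / n : ℝ) : EReal)) atTop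

/-- The measure-theoretic (Kolmogorov-Sinai) entropy `h_μ(T)`: the supremum of `h_μ(T, ξ)` over
all finite measurable partitions `ξ`. -/
def measureEntropy {X : Type*} [MeasurableSpace X] (T : X → X) (μ : Measure X) : EReal :=
  ⨆ (k : ℕ) (ξ : X → Fin k) (_ : Measurable ξ), entropyOfPartition T μ ξ

/-- `μ` is a measure of maximal entropy for `T`: a `T`-invariant Borel probability measure whose
measure-theoretic entropy is equal to the topological entropy of `T`. -/
structure IsMME {X : Type*} [UniformSpace X] [MeasurableSpace X]
    (T : X → X) (μ : Measure X) : Prop where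
  isProbabilityMeasure : IsProbabilityMeasure μ
  measurePreserving : MeasurePreserving T μ μ
  entropy_eq : measureEntropy T μ = Dynamics.coverEntropy T Set.univ

/-- The Hausdorff dimension of a probability measure:
`HD(μ) = inf {HD(Y) : Y Borel, μ(Y) = 1}`. -/
def measureHausdorffDim {X : Type*} [EMetricSpace X] [MeasurableSpace X]
    (μ : Measure X) : ENNReal :=
  ⨅ (Y : Set X) (_ : MeasurableSet Y) (_ : μ Y = 1), dimH Y

/-- The Borel sigma-algebra of the unit circle. -/
instance Circle.instMeasurableSpaceBorel : MeasurableSpace Circle := borel Circle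

instance Circle.instBorelSpaceBorel : BorelSpace Circle := ⟨rfl⟩

/-! ### Hyperbolic reflections acting on the unit circle -/

/-- Inversion in a circle with centre `c` and radius `r` that is orthogonal to the unit circle
(that is, `‖c‖ ^ 2 = 1 + r ^ 2`) preserves the unit circle. -/
theorem norm_inversion_of_orthogonal {c : ℂ} {r : ℝ} (h : ‖c‖ ^ 2 = 1 + r ^ 2) {z : ℂ}
    (hz : ‖z‖ = 1) : ‖EuclideanGeometry.inversion c r z‖ = 1 := by
  by_cases hzc : z = c
  · subst hzc
    simpa using hz
  · have hD : ‖z - c‖ ^ 2 ≠ 0 := by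
      have : ‖z - c‖ ≠ 0 := norm_ne_zero_iff.mpr (sub_ne_zero.mpr hzc)
      positivity
    have hsq : ‖EuclideanGeometry.inversion c r z‖ ^ 2 = 1 := by
      have hz2 : ‖z‖ ^ 2 = 1 := by rw [hz]; norm_num
      have key : EuclideanGeometry.inversion c r z
          = ((r ^ 2 / ‖z - c‖ ^ 2 : ℝ) : ℂ) * (z - c) + c := by
        simp [EuclideanGeometry.inversion, dist_eq_norm, div_pow]
      rw [key]
      generalize hD' : ‖z - c‖ ^ 2 = D at hD
      rw [← Complex.normSq_eq_norm_sq, Complex.normSq_apply] at h hz2 hD' ⊢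
      simp only [Complex.sub_re, Complex.sub_im, Complex.add_re, Complex.add_im,
        Complex.mul_re, Complex.mul_im, Complex.ofReal_re, Complex.ofReal_im] at hD' ⊢
      field_simp
      linear_combination (D - r ^ 2) * D * h + r ^ 2 * D * hz2 + (r ^ 4 - r ^ 2 * D) * hD'
    have h0 : 0 ≤ ‖EuclideanGeometry.inversion c r z‖ := norm_nonneg _
    nlinarith

theorem continuous_inversion_circle {c : ℂ} {r : ℝ} (hr : r ≠ 0) (h : ‖c‖ ^ 2 = 1 + r ^ 2) :
    Continuous fun z : Circle => (⟨EuclideanGeometry.inversion c r z,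
      mem_sphere_zero_iff_norm.2 (norm_inversion_of_orthogonal h z.norm_coe)⟩ : Circle) := by
  refine Continuous.subtype_mk ?_ _
  refine Continuous.inversion continuous_const continuous_const continuous_subtype_val ?_
  rintro z rfl
  rw [Circle.norm_coe] at h
  apply hr
  nlinarith [sq_nonneg r]

/-- The action on the unit circle of the reflection in the hyperbolic geodesic of the unit disk
cut out by the Euclidean circle with centre `c` and radius `r` orthogonal to the unit circle. -/
def hypReflection (c : ℂ) (r : ℝ) (hr : r ≠ 0) (h : ‖c‖ ^ 2 = 1 + r ^ 2) : Circle ≃ₜ Circle where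
  toFun z := ⟨EuclideanGeometry.inversion c r z,
    mem_sphere_zero_iff_norm.2 (norm_inversion_of_orthogonal h z.norm_coe)⟩
  invFun z := ⟨EuclideanGeometry.inversion c r z,
    mem_sphere_zero_iff_norm.2 (norm_inversion_of_orthogonal h z.norm_coe)⟩
  left_inv z := Circle.ext (EuclideanGeometry.inversion_inversion c hr z)
  right_inv z := Circle.ext (EuclideanGeometry.inversion_inversion c hr z)
  continuous_toFun := continuous_inversion_circle hr h
  continuous_invFun := continuous_inversion_circle hr h

/-- The centre of the Euclidean circle through `exp (π i j / d)` and `exp (π i (j + 1) / d)` that is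
orthogonal to the unit circle. -/
def sideCenter (d : ℕ) (j : Fin d) : ℂ :=
  ((Real.cos (π / (2 * d)))⁻¹ : ℝ) * (Circle.exp (π * (2 * (j : ℕ) + 1) / (2 * d)) : ℂ)

/-- The radius of the Euclidean circle through `exp (π i j / d)` and `exp (π i (j + 1) / d)` that is
orthogonal to the unit circle. -/
def sideRadius (d : ℕ) : ℝ := Real.tan (π / (2 * d))

theorem sideAngle_mem {d : ℕ} (hd : 2 ≤ d) : 0 < π / (2 * d) ∧ π / (2 * d) < π / 2 := by
  have h2 : (2 : ℝ) ≤ d := by exact_mod_cast hd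
  refine ⟨by positivity, ?_⟩
  apply div_lt_div_of_pos_left Real.pi_pos (by norm_num)
  linarith

theorem sideRadius_ne_zero {d : ℕ} (hd : 2 ≤ d) : sideRadius d ≠ 0 :=
  (Real.tan_pos_of_pos_of_lt_pi_div_two (sideAngle_mem hd).1 (sideAngle_mem hd).2).ne'

theorem norm_sideCenter_sq {d : ℕ} (hd : 2 ≤ d) (j : Fin d) :
    ‖sideCenter d j‖ ^ 2 = 1 + sideRadius d ^ 2 := by
  have hc : 0 < Real.cos (π / (2 * d)) :=
    Real.cos_pos_of_mem_Ioo ⟨by linarith [(sideAngle_mem hd).1, Real.pi_pos], (sideAngle_mem hd).2⟩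
  rw [sideCenter, sideRadius, norm_mul, Circle.norm_coe, mul_one, Complex.norm_real,
    Real.norm_eq_abs, sq_abs, Real.tan_eq_sin_div_cos]
  field_simp
  linarith [Real.sin_sq_add_cos_sq (π / (2 * d))]

/-! ### The punctured sphere group and its Bowen-Series maps -/

/-- The generator `g_{j+1}` (for `j = 0, …, d - 1`), as a map of the unit circle: reflection in the
hyperbolic geodesic joining `exp (π i j / d)` and `exp (π i (j + 1) / d)`, followed by complex
conjugation (which is `z ↦ z⁻¹` on the unit circle). -/
def sideGenerator {d : ℕ} (hd : 2 ≤ d) (j : Fin d) : Circle ≃ₜ Circle :=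
  (hypReflection (sideCenter d j) (sideRadius d) (sideRadius_ne_zero hd)
    (norm_sideCenter_sq hd j)).trans (Homeomorph.inv Circle)

/-- The Fuchsian group `G_d` generated by `g_1, …, g_d`, uniformizing a `(d + 1)`-times punctured
sphere, in its action on the unit circle (a Möbius automorphism of the unit disk is determined by
its action on the unit circle). -/
def puncturedSphereGroup {d : ℕ} (hd : 2 ≤ d) : Subgroup (Circle ≃ₜ Circle) :=
  Subgroup.closure (Set.range (sideGenerator hd))

/-- The half-open arc `[a, b)` of the unit circle, traversed counter-clockwise from `a` to `b`. -/
def ccwArc (a b : Circle) : Set Circle :=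
  {z | ∃ s t : ℝ, 0 ≤ s ∧ s < t ∧ t < 2 * π ∧ b = Circle.exp t * a ∧ z = Circle.exp s * a}

/-- An ideal polygon in the unit disk decorated with side-pairing transformations: side `i` is the
geodesic from `vertex i` to the cyclically next vertex (vertices listed counter-clockwise), and
`pairing i` is the transformation (in its action on the circle) that carries it to another side. -/
structure MarkedIdealPolygon (n : ℕ) where
  vertex : Fin n → Circle
  pairing : Fin n → (Circle ≃ₜ Circle)

/-- The translate `γ · R`: its sides are the images of the sides of `R` under `γ`, and its side
pairings are the conjugates by `γ` of the side pairings of `R`. -/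
def MarkedIdealPolygon.translate {n : ℕ} (R : MarkedIdealPolygon n) (γ : Circle ≃ₜ Circle) :
    MarkedIdealPolygon n where
  vertex i := γ (R.vertex i)
  pairing i := γ * R.pairing i * γ⁻¹

open Classical in
/-- The Bowen-Series map of a marked ideal polygon: it acts as the pairing of the `i`-th side on
the counter-clockwise arc `[vertex i, vertex (i + 1))` that the side subtends. -/
def MarkedIdealPolygon.bowenSeriesMap {n : ℕ} (R : MarkedIdealPolygon n) : Circle → Circle :=
  fun z =>
    if h : ∃ i, z ∈ ccwArc (R.vertex i) (R.vertex (finRotate n i)) then R.pairing h.choose z else z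

/-- The preferred fundamental domain `R` of `G_d`: the ideal polygon with vertices at the `2d`-th
roots of unity `exp (π i k / d)`, `k = 0, …, 2d - 1`. The side starting at `exp (π i k / d)` with
`k < d` is paired by `g_{k+1}`; its mirror image in the real axis, which starts at
`exp (π i (2d - 1 - k) / d)`, is paired by `g_{k+1}⁻¹`. -/
def preferredDomain {d : ℕ} (hd : 2 ≤ d) : MarkedIdealPolygon (2 * d) where
  vertex k := Circle.exp (π * (k : ℕ) / d)
  pairing k :=
    if h : (k : ℕ) < d then sideGenerator hd ⟨k, h⟩
    else (sideGenerator hd ⟨2 * d - 1 - k, by omega⟩)⁻¹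

end

/-! ### Shannon entropy of finite partitions -/

section FiniteEntropy

/-! In the angle measured from the midpoint of each arc, every side pairing of `R` is, up to
rotations, the same Blaschke factor with parameter `cos α`, where `α = π / (2 d)`. The branches glue
to a continuous circle map of degree `N = 2 d - 1`. The derivative of its lift exceeds 1 inside each
arc and equals 1 only at the vertices, so the lift strictly increases distances. This weak expansion
suffices: `exists_conjugacy_bowenSeriesMap` conjugates `A` to multiplication by `N` on `ℝ / ℤ`.

For multiplication by `N`, grids of rational points give topological entropy `log N`. The base `N`
digits form a generator with `N` symbols, so no invariant probability measure has entropy above `log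
N`. Equality forces each new digit to be uniform and independent of the earlier ones, hence forces
Lebesgue measure (`isMME_circleMul_iff`). The unique measure of maximal entropy `ν` of `A` is
therefore the image of Lebesgue measure under the conjugacy.

Quasi-invariance rests on `bowenSeriesMap_dichotomy`: at every point a side pairing `p` either
agrees with `A` or is undone by `A`. The first case preserves null sets because `ν` is invariant.
The second does because `A ⁻¹' (A '' E)` is null when `E` is: in the linear model it is a finite
union of translates of `E`. Since the inverse of a side pairing is again a side pairing, this
extends to the whole group.

Group elements preserve half-open counter-clockwise arcs, so `γ` conjugates `A` to the map of the
translated domain, whose unique measure of maximal entropy is the image of `ν` under `γ`. All these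
measures lie in the class of `ν`, and they share its Hausdorff dimension because `γ` is bi-Lipschitz
on the circle. -/

theorem sub_le_mul_log_sub_mul_log {x y : ℝ} (hx : 0 ≤ x) (hy : 0 ≤ y) (h : y = 0 → x = 0) :
    x - y ≤ x * log x - x * log y := by
  rcases hx.eq_or_lt with rfl | hx
  · simpa using hy
  · have hy : 0 < y := lt_of_le_of_ne hy fun h0 => hx.ne' (h h0.symm)
    have h1 := Real.log_le_sub_one_of_pos (div_pos hy hx)
    rw [Real.log_div hy.ne' hx.ne'] at h1
    have h2 := mul_le_mul_of_nonneg_left h1 hx.le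
    have h3 : x * (y / x - 1) = y - x := by field_simp
    linarith

/-- Equality case of Gibbs' inequality: `log t < t - 1` unless `t = 1`, applied to `t = y / x`. The
implication `y = 0 → x = 0` is needed because of the convention `log 0 = 0`. -/
theorem eq_of_mul_log_sub_mul_log_le {x y : ℝ} (hx : 0 ≤ x) (hy : 0 ≤ y) (h : y = 0 → x = 0)
    (hle : x * log x - x * log y ≤ x - y) : x = y := by
  rcases hx.eq_or_lt with rfl | hx
  · simp at hle
    linarith
  · have hy : 0 < y := lt_of_le_of_ne hy fun h0 => hx.ne' (h h0.symm)
    by_contra hne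
    have h1 := Real.log_lt_sub_one_of_pos (div_pos hy hx)
      (fun h => hne ((div_eq_one_iff_eq hx.ne').1 h).symm)
    rw [Real.log_div hy.ne' hx.ne'] at h1
    have h2 := mul_lt_mul_of_pos_left h1 hx
    have h3 : x * (y / x - 1) = y - x := by field_simp
    linarith

/-- Each term is at most the whole sum, hence so is its logarithm; weight by `p i` and add. -/
theorem negMulLog_sum_le {ι : Type*} (s : Finset ι) (p : ι → ℝ) (hp : ∀ i, 0 ≤ p i) :
    negMulLog (∑ i ∈ s, p i) ≤ ∑ i ∈ s, negMulLog (p i) := by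
  rw [negMulLog, ← Finset.sum_neg_distrib, Finset.sum_mul]
  refine Finset.sum_le_sum fun i hi => ?_
  rcases (hp i).eq_or_lt with h | h
  · simp [negMulLog, ← h]
  · have : p i ≤ ∑ i ∈ s, p i := Finset.single_le_sum (fun j _ => hp j) hi
    have := Real.log_le_log h this
    simp only [negMulLog]
    nlinarith

variable {X ι κ τ : Type*} [MeasurableSpace X] {μ : Measure X} [IsFiniteMeasure μ]
  [Fintype ι] [MeasurableSpace ι] [MeasurableSingletonClass ι]
  [Fintype κ] [MeasurableSpace κ] [MeasurableSingletonClass κ]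
  [Fintype τ] [MeasurableSpace τ] [MeasurableSingletonClass τ]

theorem sum_measureReal_inter_fiber {ξ : X → ι} (hξ : Measurable ξ) (S : Set X) :
    ∑ i, μ.real (S ∩ ξ ⁻¹' {i}) = μ.real S := by
  have := sum_measureReal_preimage_singleton (μ := μ.restrict S) (f := ξ) Finset.univ
    (fun y _ => hξ (measurableSet_singleton y))
  simp only [Finset.coe_univ, Set.preimage_univ] at this
  rw [measureReal_restrict_apply MeasurableSet.univ, Set.univ_inter] at this
  rw [← this]
  refine Finset.sum_congr rfl fun i _ => ?_
  rw [measureReal_restrict_apply (hξ (measurableSet_singleton i)), Set.inter_comm]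

/-- Coarsening a partition decreases its entropy. -/
theorem partitionEntropy_comp_le {ξ : X → ι} (hξ : Measurable ξ) (f : ι → κ) :
    partitionEntropy μ (f ∘ ξ) ≤ partitionEntropy μ ξ := by
  classical
  have key : ∀ k, μ.real ((f ∘ ξ) ⁻¹' {k}) = ∑ i with f i = k, μ.real (ξ ⁻¹' {i}) := by
    intro k
    rw [sum_measureReal_preimage_singleton _ (fun y _ => hξ (measurableSet_singleton y))]
    congr 1
    ext x
    simp
  rw [partitionEntropy, partitionEntropy, ← Finset.sum_fiberwise _ f]
  refine Finset.sum_le_sum fun k _ => ?_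
  rw [key]
  exact negMulLog_sum_le _ _ fun _ => measureReal_nonneg

theorem partitionEntropy_le_of_eq_comp {ξ : X → ι} (hξ : Measurable ξ) {ζ : X → κ} (f : ι → κ)
    (h : ∀ x, ζ x = f (ξ x)) : partitionEntropy μ ζ ≤ partitionEntropy μ ξ := by
  obtain rfl : ζ = f ∘ ξ := funext h
  exact partitionEntropy_comp_le hξ f

/-- Conditional entropy of `ξ` given `ζ`. -/
noncomputable def condPartitionEntropy (μ : Measure X) (ξ : X → ι) (ζ : X → κ) : ℝ :=
  partitionEntropy μ (fun x => (ξ x, ζ x)) - partitionEntropy μ ζ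

theorem preimage_pair (ξ : X → ι) (ζ : X → κ) (i : ι) (k : κ) :
    (fun x => (ξ x, ζ x)) ⁻¹' {(i, k)} = ξ ⁻¹' {i} ∩ ζ ⁻¹' {k} := by
  ext x
  simp

/-- Strong subadditivity of the entropy of partitions. -/
theorem partitionEntropy_strong_subadditivity {a : X → ι} {b : X → κ} {c : X → τ}
    (ha : Measurable a) (hb : Measurable b) :
    partitionEntropy μ (fun x => (a x, b x, c x)) + partitionEntropy μ c ≤
      partitionEntropy μ (fun x => (a x, c x)) + partitionEntropy μ (fun x => (b x, c x)) := by
  set p : ι → κ → τ → ℝ := fun i j k => μ.real (a ⁻¹' {i} ∩ (b ⁻¹' {j} ∩ c ⁻¹' {k})) with hp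
  set pa : ι → τ → ℝ := fun i k => μ.real (a ⁻¹' {i} ∩ c ⁻¹' {k}) with hpa
  set pb : κ → τ → ℝ := fun j k => μ.real (b ⁻¹' {j} ∩ c ⁻¹' {k}) with hpb
  set pc : τ → ℝ := fun k => μ.real (c ⁻¹' {k}) with hpc
  have sa : ∀ i k, ∑ j, p i j k = pa i k := fun i k => by
    rw [show pa i k = μ.real (a ⁻¹' {i} ∩ c ⁻¹' {k}) from rfl, ← sum_measureReal_inter_fiber hb]
    refine Finset.sum_congr rfl fun j _ => ?_
    simp only [hp]
    congr 1
    ext x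
    simp only [Set.mem_inter_iff]
    tauto
  have sb : ∀ j k, ∑ i, p i j k = pb j k := fun j k => by
    rw [show pb j k = μ.real (b ⁻¹' {j} ∩ c ⁻¹' {k}) from rfl, ← sum_measureReal_inter_fiber ha]
    refine Finset.sum_congr rfl fun i _ => ?_
    simp only [hp]
    congr 1
    ext x
    simp only [Set.mem_inter_iff]
    tauto
  have sac : ∀ k, ∑ i, pa i k = pc k := fun k => by
    rw [show pc k = μ.real (c ⁻¹' {k}) from rfl, ← sum_measureReal_inter_fiber ha]
    refine Finset.sum_congr rfl fun i _ => ?_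
    simp only [hpa]
    congr 1
    exact Set.inter_comm _ _
  have sbc : ∀ k, ∑ j, pb j k = pc k := fun k => by
    rw [show pc k = μ.real (c ⁻¹' {k}) from rfl, ← sum_measureReal_inter_fiber hb]
    refine Finset.sum_congr rfl fun i _ => ?_
    simp only [hpb]
    congr 1
    exact Set.inter_comm _ _
  have p0 : ∀ i j k, 0 ≤ p i j k := fun _ _ _ => measureReal_nonneg
  have pa0 : ∀ i k, 0 ≤ pa i k := fun _ _ => measureReal_nonneg
  have pb0 : ∀ i k, 0 ≤ pb i k := fun _ _ => measureReal_nonneg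
  have pc0 : ∀ k, 0 ≤ pc k := fun _ => measureReal_nonneg
  have lea : ∀ i j k, p i j k ≤ pa i k := fun i j k => by
    rw [← sa]; exact Finset.single_le_sum (f := fun j => p i j k) (fun j _ => p0 i j k)
      (Finset.mem_univ j)
  have leb : ∀ i j k, p i j k ≤ pb j k := fun i j k => by
    rw [← sb]; exact Finset.single_le_sum (f := fun i => p i j k) (fun i _ => p0 i j k)
      (Finset.mem_univ i)
  have lec : ∀ i k, pa i k ≤ pc k := fun i k => by
    rw [← sac]; exact Finset.single_le_sum (f := fun i => pa i k) (fun i _ => pa0 i k)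
      (Finset.mem_univ i)
  -- Gibbs' inequality against the law making `a` and `b` conditionally independent given `c`. Both
  -- laws have mass `pc k` on each fibre of `c`, so the linear terms cancel on summation.
  have pointwise : ∀ i j k, p i j k - pa i k * pb j k / pc k ≤
      p i j k * log (p i j k) - p i j k * log (pa i k) - p i j k * log (pb j k)
        + p i j k * log (pc k) := by
    intro i j k
    rcases (p0 i j k).eq_or_lt with h | h
    · rw [← h]
      have : 0 ≤ pa i k * pb j k / pc k := div_nonneg (mul_nonneg (pa0 _ _) (pb0 _ _)) (pc0 _)
      simpa using this
    · have h1 := h.trans_le (lea i j k)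
      have h2 := h.trans_le (leb i j k)
      have h3 := h1.trans_le (lec i k)
      have := sub_le_mul_log_sub_mul_log h.le (y := pa i k * pb j k / pc k) (by positivity)
        (fun h0 => absurd h0 (by positivity))
      rw [Real.log_div (by positivity) h3.ne', Real.log_mul h1.ne' h2.ne'] at this
      linarith
  have total : ∑ k, ∑ i, ∑ j, (p i j k - pa i k * pb j k / pc k) = 0 := by
    refine Finset.sum_eq_zero fun k _ => ?_
    simp only [Finset.sum_sub_distrib, sa, ← Finset.sum_div, ← Finset.mul_sum, sbc, sac,
      ← Finset.sum_mul]
    rcases eq_or_ne (pc k) 0 with h | h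
    · simp [h]
    · field_simp; ring
  have H := Finset.sum_le_sum fun k (_ : k ∈ Finset.univ) => Finset.sum_le_sum
    fun i (_ : i ∈ Finset.univ) => Finset.sum_le_sum fun j (_ : j ∈ Finset.univ) =>
      pointwise i j k
  rw [total] at H
  simp only [Finset.sum_add_distrib, Finset.sum_sub_distrib] at H
  have e1 : ∑ k, ∑ i, ∑ j, p i j k * log (p i j k)
      = - partitionEntropy μ (fun x => (a x, b x, c x)) := by
    rw [partitionEntropy, Fintype.sum_prod_type]
    simp only [Fintype.sum_prod_type, preimage_pair, negMulLog, neg_mul, Finset.sum_neg_distrib,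
      neg_neg]
    rw [Finset.sum_comm]
    refine Finset.sum_congr rfl fun i _ => Finset.sum_comm
  have e2 : ∑ k, ∑ i, ∑ j, p i j k * log (pa i k)
      = - partitionEntropy μ (fun x => (a x, c x)) := by
    rw [partitionEntropy, Fintype.sum_prod_type]
    simp only [preimage_pair, negMulLog, neg_mul, Finset.sum_neg_distrib, neg_neg,
      ← Finset.sum_mul, sa]
    rw [Finset.sum_comm]
  have e3 : ∑ k, ∑ i, ∑ j, p i j k * log (pb j k)
      = - partitionEntropy μ (fun x => (b x, c x)) := by
    have : ∀ k, ∑ i, ∑ j, p i j k * log (pb j k) = ∑ j, pb j k * log (pb j k) := fun k => by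
      rw [Finset.sum_comm]
      simp only [← Finset.sum_mul, sb]
    simp only [this]
    rw [partitionEntropy, Fintype.sum_prod_type]
    simp only [preimage_pair, negMulLog, neg_mul, Finset.sum_neg_distrib, neg_neg]
    rw [Finset.sum_comm]
  have e4 : ∑ k, ∑ i, ∑ j, p i j k * log (pc k) = - partitionEntropy μ c := by
    rw [partitionEntropy]
    simp only [negMulLog, neg_mul, Finset.sum_neg_distrib, neg_neg, ← Finset.sum_mul, sa, sac]
    rfl
  rw [e1, e2, e3, e4] at H
  linarith

/-- Conditioning on more information lowers entropy: this is strong subadditivity over `ω`, since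
adjoining `ω` to `ζ` adds nothing. -/
theorem condPartitionEntropy_le_of_eq_comp {ξ : X → ι} {ζ : X → κ} {ω : X → τ}
    (hξ : Measurable ξ) (hζ : Measurable ζ) (hω : Measurable ω) (f : κ → τ)
    (h : ∀ x, ω x = f (ζ x)) :
    condPartitionEntropy μ ξ ζ ≤ condPartitionEntropy μ ξ ω := by
  have h1 := partitionEntropy_strong_subadditivity (μ := μ) (c := ω) hξ hζ
  have h2 : partitionEntropy μ (fun x => (ξ x, ζ x)) ≤
      partitionEntropy μ (fun x => (ξ x, ζ x, ω x)) :=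
    partitionEntropy_le_of_eq_comp (by fun_prop) (fun q => (q.1, q.2.1)) (fun _ => rfl)
  have h3 : partitionEntropy μ (fun x => (ζ x, ω x)) ≤ partitionEntropy μ ζ :=
    partitionEntropy_le_of_eq_comp hζ (fun q => (q, f q)) (fun x => by rw [h])
  unfold condPartitionEntropy
  linarith

theorem condPartitionEntropy_pair_le {ξ : X → ι} {ζ : X → κ} {ω : X → τ}
    (hξ : Measurable ξ) (hζ : Measurable ζ) (hω : Measurable ω) :
    condPartitionEntropy μ (fun x => (ξ x, ζ x)) ω ≤
      condPartitionEntropy μ ξ ω + condPartitionEntropy μ ζ ω := by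
  have h1 := partitionEntropy_strong_subadditivity (μ := μ) (c := ω) hξ hζ
  have h2 : partitionEntropy μ (fun x => ((ξ x, ζ x), ω x)) ≤
      partitionEntropy μ (fun x => (ξ x, ζ x, ω x)) :=
    partitionEntropy_le_of_eq_comp (by fun_prop) (fun q => ((q.1, q.2.1), q.2.2)) (fun _ => rfl)
  unfold condPartitionEntropy
  linarith

theorem condPartitionEntropy_mono_left {ξ : X → ι} {ζ : X → κ} {ω : X → τ}
    (hζ : Measurable ζ) (hω : Measurable ω) (f : κ → ι) (h : ∀ x, ξ x = f (ζ x)) :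
    condPartitionEntropy μ ξ ω ≤ condPartitionEntropy μ ζ ω := by
  unfold condPartitionEntropy
  have : partitionEntropy μ (fun x => (ξ x, ω x)) ≤ partitionEntropy μ (fun x => (ζ x, ω x)) :=
    partitionEntropy_le_of_eq_comp (by fun_prop) (fun q => (f q.1, q.2)) (fun x => by rw [h])
  linarith

theorem condPartitionEntropy_eq_sum {ξ : X → ι} {ζ : X → κ} (hξ : Measurable ξ) :
    condPartitionEntropy μ ξ ζ = ∑ i, ∑ k, (negMulLog (μ.real (ξ ⁻¹' {i} ∩ ζ ⁻¹' {k})) +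
      μ.real (ξ ⁻¹' {i} ∩ ζ ⁻¹' {k}) * log (μ.real (ζ ⁻¹' {k}))) := by
  simp only [Finset.sum_add_distrib]
  rw [condPartitionEntropy, sub_eq_add_neg]
  congr 1
  · rw [partitionEntropy, Fintype.sum_prod_type]
    simp only [preimage_pair]
  · rw [partitionEntropy, Finset.sum_comm, ← Finset.sum_neg_distrib]
    refine Finset.sum_congr rfl fun k _ => ?_
    rw [← Finset.sum_mul, ← sum_measureReal_inter_fiber hξ (ζ ⁻¹' {k})]
    simp only [negMulLog, neg_mul, neg_neg, Set.inter_comm]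

/-- The defect is a sum of Gibbs defects between the joint law and the product of the uniform law on
`ι` with the law of `ζ`. Both have total mass 1, so the linear corrections cancel. The summands are
nonnegative, which yields both the upper bound and its equality case. -/
theorem log_card_sub_condPartitionEntropy [IsProbabilityMeasure μ] [Nonempty ι]
    {ξ : X → ι} {ζ : X → κ} (hξ : Measurable ξ) (hζ : Measurable ζ) :
    log (Fintype.card ι) - condPartitionEntropy μ ξ ζ =
      ∑ i, ∑ k, (μ.real (ξ ⁻¹' {i} ∩ ζ ⁻¹' {k}) * log (μ.real (ξ ⁻¹' {i} ∩ ζ ⁻¹' {k})) -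
        μ.real (ξ ⁻¹' {i} ∩ ζ ⁻¹' {k}) * log (μ.real (ζ ⁻¹' {k}) / Fintype.card ι) -
        (μ.real (ξ ⁻¹' {i} ∩ ζ ⁻¹' {k}) - μ.real (ζ ⁻¹' {k}) / Fintype.card ι)) := by
  have hm : (Fintype.card ι : ℝ) ≠ 0 := by exact_mod_cast Fintype.card_ne_zero
  have tot : ∑ i, ∑ k, μ.real (ξ ⁻¹' {i} ∩ ζ ⁻¹' {k}) = 1 := by
    rw [← probReal_univ (μ := μ), ← sum_measureReal_inter_fiber hξ Set.univ]
    refine Finset.sum_congr rfl fun i _ => ?_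
    rw [sum_measureReal_inter_fiber hζ, Set.univ_inter]
  have totk : ∑ k, μ.real (ζ ⁻¹' {k}) = 1 := by
    rw [← probReal_univ (μ := μ), ← sum_measureReal_inter_fiber hζ Set.univ]
    simp only [Set.univ_inter]
  have tot2 : ∑ _i : ι, ∑ k, μ.real (ζ ⁻¹' {k}) / Fintype.card ι = 1 := by
    simp only [← Finset.sum_div, totk]
    simp [hm]
  have hlog : log (Fintype.card ι) =
      ∑ i, ∑ k, μ.real (ξ ⁻¹' {i} ∩ ζ ⁻¹' {k}) * log (Fintype.card ι) := by
    simp only [← Finset.sum_mul, tot, one_mul]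
  rw [condPartitionEntropy_eq_sum hξ]
  simp only [Finset.sum_sub_distrib, tot, tot2, sub_self, sub_zero]
  conv_lhs => rw [hlog]
  simp only [← Finset.sum_sub_distrib]
  refine Finset.sum_congr rfl fun i _ => Finset.sum_congr rfl fun k _ => ?_
  rcases eq_or_ne (μ.real (ζ ⁻¹' {k})) 0 with h | h
  · have : μ.real (ξ ⁻¹' {i} ∩ ζ ⁻¹' {k}) = 0 :=
      le_antisymm (h ▸ measureReal_mono Set.inter_subset_right) measureReal_nonneg
    simp [this]
  · rw [Real.log_div h hm, negMulLog]
    ring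

theorem measureReal_inter_eq_zero_of_div_card [Nonempty ι] (ξ : X → ι) (ζ : X → κ) (i : ι) (k : κ) :
    μ.real (ζ ⁻¹' {k}) / Fintype.card ι = 0 → μ.real (ξ ⁻¹' {i} ∩ ζ ⁻¹' {k}) = 0 := by
  have hm : (Fintype.card ι : ℝ) ≠ 0 := by exact_mod_cast Fintype.card_ne_zero
  intro h
  have h' := (div_eq_zero_iff.1 h).resolve_right hm
  exact le_antisymm (h' ▸ measureReal_mono Set.inter_subset_right) measureReal_nonneg

theorem condPartitionEntropy_le_log_card [IsProbabilityMeasure μ] [Nonempty ι]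
    {ξ : X → ι} {ζ : X → κ} (hξ : Measurable ξ) (hζ : Measurable ζ) :
    condPartitionEntropy μ ξ ζ ≤ log (Fintype.card ι) := by
  rw [← sub_nonneg, log_card_sub_condPartitionEntropy hξ hζ]
  refine Finset.sum_nonneg fun i _ => Finset.sum_nonneg fun k _ => sub_nonneg.2 ?_
  exact sub_le_mul_log_sub_mul_log measureReal_nonneg (by positivity)
    (measureReal_inter_eq_zero_of_div_card ξ ζ i k)

theorem measureReal_inter_eq_of_log_card_le [IsProbabilityMeasure μ] [Nonempty ι]
    {ξ : X → ι} {ζ : X → κ} (hξ : Measurable ξ) (hζ : Measurable ζ)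
    (h : log (Fintype.card ι) ≤ condPartitionEntropy μ ξ ζ) (i : ι) (k : κ) :
    μ.real (ξ ⁻¹' {i} ∩ ζ ⁻¹' {k}) = μ.real (ζ ⁻¹' {k}) / Fintype.card ι := by
  have h0 := log_card_sub_condPartitionEntropy (μ := μ) hξ hζ
  have hterm : ∀ i k, 0 ≤ μ.real (ξ ⁻¹' {i} ∩ ζ ⁻¹' {k}) * log (μ.real (ξ ⁻¹' {i} ∩ ζ ⁻¹' {k})) -
        μ.real (ξ ⁻¹' {i} ∩ ζ ⁻¹' {k}) * log (μ.real (ζ ⁻¹' {k}) / Fintype.card ι) -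
        (μ.real (ξ ⁻¹' {i} ∩ ζ ⁻¹' {k}) - μ.real (ζ ⁻¹' {k}) / Fintype.card ι) := fun i k =>
    sub_nonneg.2 (sub_le_mul_log_sub_mul_log measureReal_nonneg (by positivity)
      (measureReal_inter_eq_zero_of_div_card ξ ζ i k))
  have h1 := Finset.single_le_sum
    (fun i _ => Finset.sum_nonneg (s := Finset.univ) fun k _ => hterm i k)
    (Finset.mem_univ i)
  have h2 := Finset.single_le_sum (fun k _ => hterm i k) (Finset.mem_univ k)
  refine eq_of_mul_log_sub_mul_log_le measureReal_nonneg (by positivity)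
    (measureReal_inter_eq_zero_of_div_card ξ ζ i k) ?_
  linarith

end FiniteEntropy

/-! ### Generators and Kolmogorov-Sinai entropy -/

section Generators

variable {X ι κ : Type*} [MeasurableSpace X] {μ : Measure X} {T : X → X}
  [Fintype ι] [MeasurableSpace ι] [MeasurableSingletonClass ι]
  [Fintype κ] [MeasurableSpace κ] [MeasurableSingletonClass κ]

theorem measurable_itinerary (hT : Measurable T) {ξ : X → ι} (hξ : Measurable ξ) (n : ℕ) :
    Measurable (itinerary T ξ n) :=
  measurable_pi_iff.2 fun i => hξ.comp (hT.iterate i)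

theorem partitionEntropy_comp_measurePreserving {g : X → X} (hg : MeasurePreserving g μ μ)
    {ξ : X → ι} (hξ : Measurable ξ) :
    partitionEntropy μ (fun x => ξ (g x)) = partitionEntropy μ ξ := by
  unfold partitionEntropy
  refine Finset.sum_congr rfl fun i _ => ?_
  congr 1
  exact hg.measureReal_preimage (hξ (measurableSet_singleton i)).nullMeasurableSet

theorem condPartitionEntropy_comp_measurePreserving {g : X → X} (hg : MeasurePreserving g μ μ)
    {ξ : X → ι} (hξ : Measurable ξ) {ζ : X → κ} (hζ : Measurable ζ) :
    condPartitionEntropy μ (fun x => ξ (g x)) (fun x => ζ (g x)) = condPartitionEntropy μ ξ ζ := by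
  unfold condPartitionEntropy
  rw [partitionEntropy_comp_measurePreserving hg hζ,
    ← partitionEntropy_comp_measurePreserving hg (hξ.prodMk hζ)]

variable [IsProbabilityMeasure μ]

theorem condPartitionEntropy_itinerary_le (hT : Measurable T) {ξ : X → ι} (hξ : Measurable ξ)
    {ζ : X → κ} (hζ : Measurable ζ) (n : ℕ) :
    condPartitionEntropy μ (itinerary T ξ n) ζ ≤
      ∑ i ∈ Finset.range n, condPartitionEntropy μ (fun x => ξ (T^[i] x)) ζ := by
  induction n with
  | zero =>
    rw [Finset.sum_range_zero, condPartitionEntropy, sub_nonpos]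
    exact partitionEntropy_le_of_eq_comp hζ (fun k => (Fin.elim0, k))
      fun x => Prod.ext (Subsingleton.elim _ _) rfl
  | succ n ih =>
    rw [Finset.sum_range_succ]
    have hn := measurable_itinerary hT hξ n
    have hξn : Measurable fun x => ξ (T^[n] x) := hξ.comp (hT.iterate n)
    refine le_trans ?_ ((condPartitionEntropy_pair_le hn hξn hζ).trans (by gcongr))
    refine condPartitionEntropy_mono_left (hn.prodMk hξn) hζ
      (fun q => Fin.snoc (α := fun _ => ι) q.1 q.2) fun x => ?_
    funext i
    refine Fin.lastCases ?_ (fun j => ?_) i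
    · simp [itinerary]
    · simp [itinerary]

/-- An itinerary of length `M` contains the length `m` itinerary of `T^[i] x`; drop the other
symbols, then remove `T^[i]` by invariance. -/
theorem condPartitionEntropy_iterate_le (hT : MeasurePreserving T μ μ)
    {ξ : X → ι} (hξ : Measurable ξ) {P : X → κ} (hP : Measurable P) {i m M : ℕ} (h : i + m ≤ M) :
    condPartitionEntropy μ (fun x => ξ (T^[i] x)) (itinerary T P M) ≤
      condPartitionEntropy μ ξ (itinerary T P m) := by
  have hm := measurable_itinerary hT.measurable hP m
  rw [← condPartitionEntropy_comp_measurePreserving (hT.iterate i) hξ hm]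
  refine condPartitionEntropy_le_of_eq_comp (hξ.comp (hT.measurable.iterate i))
    (measurable_itinerary hT.measurable hP M) (hm.comp (hT.measurable.iterate i))
    (fun w j => w ⟨i + j, by omega⟩) fun x => ?_
  funext j
  simp only [itinerary]
  rw [← Function.iterate_add_apply, add_comm]

/-- Join the two itineraries. Given the `P`-itinerary, each of the `n` symbols of `ξ` costs at most
its entropy given the next `m` symbols of `P`, which is why the window is `n + m`. -/
theorem partitionEntropy_itinerary_le (hT : MeasurePreserving T μ μ)
    {ξ : X → ι} (hξ : Measurable ξ) {P : X → κ} (hP : Measurable P) (n m : ℕ) :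
    partitionEntropy μ (itinerary T ξ n) ≤
      partitionEntropy μ (itinerary T P (n + m)) +
        n * condPartitionEntropy μ ξ (itinerary T P m) := by
  have hPn := measurable_itinerary hT.measurable hP (n + m)
  have hξn := measurable_itinerary hT.measurable hξ n
  have h1 : partitionEntropy μ (itinerary T ξ n) ≤
      partitionEntropy μ (fun x => (itinerary T ξ n x, itinerary T P (n + m) x)) :=
    partitionEntropy_le_of_eq_comp (hξn.prodMk hPn) Prod.fst fun _ => rfl
  have h2 := condPartitionEntropy_itinerary_le (μ := μ) hT.measurable hξ hPn n
  have h3 : ∑ i ∈ Finset.range n,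
      condPartitionEntropy μ (fun x => ξ (T^[i] x)) (itinerary T P (n + m)) ≤
      ∑ _i ∈ Finset.range n, condPartitionEntropy μ ξ (itinerary T P m) :=
    Finset.sum_le_sum fun i hi => condPartitionEntropy_iterate_le hT hξ hP
      (by have := Finset.mem_range.1 hi; omega)
  rw [Finset.sum_const, Finset.card_range, nsmul_eq_mul] at h3
  rw [condPartitionEntropy] at h2
  linarith

theorem partitionEntropy_itinerary_succ (hT : Measurable T) {P : X → κ} (hP : Measurable P)
    (n : ℕ) :
    partitionEntropy μ (itinerary T P (n + 1)) =
      partitionEntropy μ (itinerary T P n) +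
        condPartitionEntropy μ (fun x => P (T^[n] x)) (itinerary T P n) := by
  rw [condPartitionEntropy, add_sub_cancel]
  have hn := measurable_itinerary hT hP n
  have hPn : Measurable fun x => P (T^[n] x) := hP.comp (hT.iterate n)
  apply le_antisymm
  · refine partitionEntropy_le_of_eq_comp (hPn.prodMk hn)
      (fun q => Fin.snoc (α := fun _ => κ) q.2 q.1) fun x => ?_
    funext i
    refine Fin.lastCases ?_ (fun j => ?_) i
    · simp [itinerary]
    · simp [itinerary]
  · exact partitionEntropy_le_of_eq_comp (measurable_itinerary hT hP (n + 1))
      (fun w => (w (Fin.last n), fun j => w j.castSucc)) fun x => rfl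

/-- By invariance, predicting symbol `n` from symbols `0, …, n - 1` costs the same as predicting
symbol `n + 1` from symbols `1, …, n`; revealing symbol `0` as well only lowers the cost. -/
theorem condPartitionEntropy_itinerary_antitone (hT : MeasurePreserving T μ μ) {P : X → κ}
    (hP : Measurable P) :
    Antitone fun n => condPartitionEntropy μ (fun x => P (T^[n] x)) (itinerary T P n) := by
  refine antitone_nat_of_succ_le fun n => ?_
  have hn := measurable_itinerary hT.measurable hP n
  have hPn : Measurable fun x => P (T^[n] x) := hP.comp (hT.measurable.iterate n)
  rw [← condPartitionEntropy_comp_measurePreserving hT hPn hn]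
  exact condPartitionEntropy_le_of_eq_comp (hP.comp (hT.measurable.iterate (n + 1)))
    (measurable_itinerary hT.measurable hP (n + 1)) (hn.comp hT.measurable)
    (fun w j => w j.succ) fun x => rfl

/-- The sets determined by finitely many symbols of the itinerary. -/
def cylinderAlgebra (T : X → X) (P : X → κ) : Set (Set X) :=
  {S | ∃ (m : ℕ) (D : Set (Fin m → κ)), S = itinerary T P m ⁻¹' D}

theorem exists_preimage_itinerary_of_le {P : X → κ} {m M : ℕ} (h : m ≤ M) (D : Set (Fin m → κ)) :
    ∃ D' : Set (Fin M → κ), itinerary T P m ⁻¹' D = itinerary T P M ⁻¹' D' :=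
  ⟨{w | (fun j : Fin m => w ⟨j, by omega⟩) ∈ D}, rfl⟩

theorem isSetAlgebra_cylinderAlgebra (T : X → X) (P : X → κ) :
    IsSetAlgebra (cylinderAlgebra T P) where
  empty_mem := ⟨0, ∅, rfl⟩
  compl_mem := by
    rintro _ ⟨m, D, rfl⟩
    exact ⟨m, Dᶜ, rfl⟩
  union_mem := by
    rintro _ _ ⟨m, D, rfl⟩ ⟨m', D', rfl⟩
    obtain ⟨E, hE⟩ := exists_preimage_itinerary_of_le (T := T) (P := P) (le_max_left m m') D
    obtain ⟨E', hE'⟩ := exists_preimage_itinerary_of_le (T := T) (P := P) (le_max_right m m') D'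
    exact ⟨max m m', E ∪ E', by rw [hE, hE']; rfl⟩

/-- `P` is a generator for `T`: the full itineraries generate the σ-algebra. -/
def IsGenerator (T : X → X) (P : X → κ) : Prop :=
  ‹MeasurableSpace X› ≤ MeasurableSpace.comap (fun x (n : ℕ) => P (T^[n] x)) inferInstance

theorem IsGenerator.eq_generateFrom {P : X → κ} (hgen : IsGenerator T P) (hT : Measurable T)
    (hP : Measurable P) :
    ‹MeasurableSpace X› = MeasurableSpace.generateFrom (cylinderAlgebra T P) := by
  apply le_antisymm
  · refine hgen.trans ?_
    rw [← measurable_iff_comap_le]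
    refine (@measurable_pi_iff _ _ _ (MeasurableSpace.generateFrom (cylinderAlgebra T P)) _ _).2
      fun n D _ => MeasurableSpace.measurableSet_generateFrom ⟨n + 1, {w | w (Fin.last n) ∈ D}, ?_⟩
    rfl
  · refine MeasurableSpace.generateFrom_le ?_
    rintro _ ⟨m, D, rfl⟩
    exact measurable_itinerary hT hP m D.toFinite.measurableSet

theorem IsGenerator.measure_eq {P : X → κ} (hgen : IsGenerator T P) (hT : Measurable T)
    (hP : Measurable P) {ν : Measure X} [IsProbabilityMeasure ν]
    (h : ∀ n (w : Fin n → κ), μ.real (itinerary T P n ⁻¹' {w}) = ν.real (itinerary T P n ⁻¹' {w})) :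
    μ = ν := by
  refine ext_of_generate_finite _ (hgen.eq_generateFrom hT hP)
    (isSetAlgebra_cylinderAlgebra T P).isSetRing.isSetSemiring.isPiSystem ?_ (by simp)
  rintro _ ⟨m, D, rfl⟩
  classical
  have key : ∀ ρ : Measure X, IsProbabilityMeasure ρ → ρ.real (itinerary T P m ⁻¹' D) =
      ∑ w ∈ D.toFinset, ρ.real (itinerary T P m ⁻¹' {w}) := fun ρ _ => by
    rw [sum_measureReal_preimage_singleton _ fun w _ =>
      measurable_itinerary hT hP m (measurableSet_singleton w)]
    simp
  have := (key μ inferInstance).trans ((Finset.sum_congr rfl fun w _ => h m w).trans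
    (key ν inferInstance).symm)
  rwa [measureReal_eq_measureReal_iff] at this

/-- Gibbs' inequality against `exp (-K) * y`. It is used where `x` has small total mass: that mass
is multiplied by `K`, while the uncontrolled mass `y` gets a small factor. -/
theorem negMulLog_add_mul_log_le {x y : ℝ} (hx : 0 ≤ x) (hy : 0 ≤ y) (h : y = 0 → x = 0) (K : ℝ) :
    negMulLog x + x * log y ≤ K * x + exp (-K) * y := by
  rcases hy.eq_or_lt with rfl | hy
  · simp [h rfl]
  have := sub_le_mul_log_sub_mul_log hx (y := exp (-K) * y) (by positivity)
    (fun h0 => absurd h0 (by positivity))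
  rw [Real.log_mul (by positivity) hy.ne', Real.log_exp] at this
  rw [negMulLog]
  nlinarith

/-- The conditional entropy of a partition given the itineraries of a generator tends to zero. -/
theorem IsGenerator.exists_condPartitionEntropy_le {P : X → κ} (hgen : IsGenerator T P)
    (hT : Measurable T) (hP : Measurable P) {ξ : X → ι} (hξ : Measurable ξ) {ε : ℝ} (hε : 0 < ε) :
    ∃ m, condPartitionEntropy μ ξ (itinerary T P m) ≤ ε := by
  classical
  set c : ℝ := (Fintype.card ι : ℝ) with hc
  have hc0 : 0 ≤ c := by positivity
  -- `K` is fixed before `δ`: summed over the `c` symbols, the terms `exp (-K)` use half of `ε`, and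
  -- then `δ` makes the terms `(K + 1) * δ` use the other half.
  obtain ⟨K, hK0, hK⟩ : ∃ K : ℝ, 0 ≤ K ∧ exp (-K) * (c + 1) ≤ ε / 2 := by
    have : Tendsto (fun K : ℝ => exp (-K) * (c + 1)) atTop (𝓝 (0 * (c + 1))) :=
      (Real.tendsto_exp_neg_atTop_nhds_zero).mul_const _
    rw [zero_mul] at this
    obtain ⟨K, hK⟩ := ((this.eventually_le_const (half_pos hε)).and (eventually_ge_atTop 0)).exists
    exact ⟨K, hK.2, hK.1⟩
  set δ : ℝ := ε / 2 / ((K + 1) * (c + 1)) with hδ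
  have hδ0 : 0 < δ := by positivity
  have dense := Measure.MeasureDense.of_generateFrom_isSetAlgebra_finite (μ := μ)
    (isSetAlgebra_cylinderAlgebra T P) (hgen.eq_generateFrom hT hP)
  have happ : ∀ i : ι, ∃ (m : ℕ) (D : Set (Fin m → κ)),
      μ.real (symmDiff (ξ ⁻¹' {i}) (itinerary T P m ⁻¹' D)) < δ := fun i => by
    obtain ⟨_, ⟨m, D, rfl⟩, h⟩ := dense.approx (ξ ⁻¹' {i}) (hξ (measurableSet_singleton i))
      (measure_ne_top _ _) δ hδ0
    exact ⟨m, D, (ENNReal.lt_ofReal_iff_toReal_lt (measure_ne_top _ _)).1 h⟩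
  choose m D hD using happ
  set M := Finset.univ.sup m with hM
  have hm : ∀ i, m i ≤ M := fun i => Finset.le_sup (Finset.mem_univ i)
  choose E hE using fun i => exists_preimage_itinerary_of_le (T := T) (P := P) (hm i) (D i)
  refine ⟨M, ?_⟩
  have hI := measurable_itinerary hT hP M
  rw [condPartitionEntropy_eq_sum hξ]
  have bound : ∀ i, ∑ w, (negMulLog (μ.real (ξ ⁻¹' {i} ∩ itinerary T P M ⁻¹' {w})) +
      μ.real (ξ ⁻¹' {i} ∩ itinerary T P M ⁻¹' {w}) * log (μ.real (itinerary T P M ⁻¹' {w}))) ≤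
      (K + 1) * δ + exp (-K) := by
    intro i
    set p : (Fin M → κ) → ℝ := fun w => μ.real (ξ ⁻¹' {i} ∩ itinerary T P M ⁻¹' {w}) with hp
    set q : (Fin M → κ) → ℝ := fun w => μ.real (itinerary T P M ⁻¹' {w}) with hq
    have hpq : ∀ w, p w ≤ q w := fun w => measureReal_mono Set.inter_subset_right
    have hp0 : ∀ w, 0 ≤ p w := fun w => measureReal_nonneg
    have h0 : ∀ w, q w = 0 → p w = 0 := fun w h => le_antisymm (h ▸ hpq w) (hp0 w)
    have sdiff : ∀ (w : Fin M → κ), q w - p w =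
        μ.real ((ξ ⁻¹' {i})ᶜ ∩ itinerary T P M ⁻¹' {w}) := fun w => by
      have h1 := measureReal_inter_add_sdiff (μ := μ) (s := itinerary T P M ⁻¹' {w})
        (hξ (measurableSet_singleton i))
      rw [Set.inter_comm, Set.sdiff_eq, Set.inter_comm _ (_ᶜ)] at h1
      exact sub_eq_iff_eq_add'.2 h1.symm
    have fib : ∀ (S : Set X) (F : Finset (Fin M → κ)),
        ∑ w ∈ F, μ.real (S ∩ itinerary T P M ⁻¹' {w}) =
          μ.real (S ∩ itinerary T P M ⁻¹' (F : Set (Fin M → κ))) := fun S F => by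
      have := sum_measureReal_preimage_singleton (μ := μ.restrict S) (f := itinerary T P M) F
        (fun y _ => hI (measurableSet_singleton y))
      rw [measureReal_restrict_apply (hI F.finite_toSet.measurableSet), Set.inter_comm] at this
      rw [← this]
      refine Finset.sum_congr rfl fun w _ => ?_
      rw [measureReal_restrict_apply (hI (measurableSet_singleton w)), Set.inter_comm]
    -- On the cylinders approximating the fibre of `i`, the plain Gibbs bound leaves the mass lying
    -- outside the fibre, at most `δ`.
    have hin : ∑ w ∈ (E i).toFinset, (negMulLog (p w) + p w * log (q w)) ≤ δ := by
      calc _ ≤ ∑ w ∈ (E i).toFinset, (q w - p w) := by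
            refine Finset.sum_le_sum fun w _ => ?_
            have := sub_le_mul_log_sub_mul_log (hp0 w) ((hp0 w).trans (hpq w)) (h0 w)
            rw [negMulLog]
            linarith
        _ = μ.real ((ξ ⁻¹' {i})ᶜ ∩ itinerary T P M ⁻¹' (E i)) := by
            rw [Finset.sum_congr rfl fun w _ => sdiff w, fib, Set.coe_toFinset]
        _ ≤ μ.real (symmDiff (ξ ⁻¹' {i}) (itinerary T P (m i) ⁻¹' D i)) := by
            refine measureReal_mono fun x hx => Or.inr ⟨?_, hx.1⟩
            rw [hE]
            exact hx.2
        _ ≤ δ := (hD i).le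
    -- On the remaining cylinders the fibre itself has mass at most `δ`, so the weighted bound
    -- applies.
    have hout : ∑ w ∈ (E i).toFinsetᶜ, (negMulLog (p w) + p w * log (q w)) ≤
        K * δ + exp (-K) := by
      calc _ ≤ ∑ w ∈ (E i).toFinsetᶜ, (K * p w + exp (-K) * q w) :=
            Finset.sum_le_sum fun w _ =>
              negMulLog_add_mul_log_le (hp0 w) ((hp0 w).trans (hpq w)) (h0 w) K
        _ = K * ∑ w ∈ (E i).toFinsetᶜ, p w + exp (-K) * ∑ w ∈ (E i).toFinsetᶜ, q w := by
            rw [Finset.sum_add_distrib, Finset.mul_sum, Finset.mul_sum]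
        _ ≤ K * δ + exp (-K) * 1 := by
            gcongr
            · rw [fib]
              refine le_trans (measureReal_mono fun x hx => ?_) (hD i).le
              refine Or.inl ⟨hx.1, fun h => ?_⟩
              rw [hE] at h
              have h2 := hx.2
              simp only [Finset.coe_compl, Set.coe_toFinset, Set.preimage_compl] at h2
              exact h2 h
            · rw [sum_measureReal_preimage_singleton _ fun w _ => hI (measurableSet_singleton w)]
              exact measureReal_le_one
        _ = _ := by rw [mul_one]
    rw [← Finset.sum_add_sum_compl (E i).toFinset]
    linarith
  refine (Finset.sum_le_sum fun i _ => bound i).trans ?_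
  rw [Finset.sum_const, Finset.card_univ, nsmul_eq_mul, ← hc]
  have h1 : c * ((K + 1) * δ) ≤ ε / 2 := by
    have : (K + 1) * (c + 1) * δ = ε / 2 := by rw [hδ]; field_simp
    nlinarith [mul_nonneg (by linarith : 0 ≤ K + 1) hδ0.le]
  have := exp_pos (-K)
  nlinarith

/-- Kolmogorov-Sinai: a generator controls the entropy of all partitions. -/
theorem IsGenerator.measureEntropy_le {P : X → κ} (hgen : IsGenerator T P)
    (hT : MeasurePreserving T μ μ) (hP : Measurable P) {a C : ℝ}
    (h : ∀ n, partitionEntropy μ (itinerary T P n) ≤ a * n + C) :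
    measureEntropy T μ ≤ a := by
  refine iSup_le fun k => iSup_le fun ξ => iSup_le fun hξ => ?_
  refine EReal.le_of_forall_lt_iff_le.1 fun b hab => ?_
  have hab : a < b := by exact_mod_cast hab
  -- Half of the gap pays for passing from `P` to `ξ` at each symbol; the other half absorbs the
  -- constant `a * m + C` once `n` is large.
  obtain ⟨m, hm⟩ := hgen.exists_condPartitionEntropy_le (μ := μ) hT.measurable hP hξ
    (half_pos (sub_pos.2 hab))
  have hev : ∀ᶠ n : ℕ in atTop, (a * m + C) / n ≤ (b - a) / 2 :=
    ((tendsto_const_div_atTop_nhds_zero_nat (a * m + C)).eventually_lt_const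
      (half_pos (sub_pos.2 hab))).mono fun _ => le_of_lt
  refine limsup_le_of_le (h := ?_)
  filter_upwards [hev, eventually_gt_atTop 0] with n hn hn0
  have hn0 : (0 : ℝ) < n := by exact_mod_cast hn0
  rw [EReal.coe_le_coe_iff, div_le_iff₀ hn0]
  rw [div_le_iff₀ hn0] at hn
  have h1 := partitionEntropy_itinerary_le hT hξ hP n m
  have h2 := h (n + m)
  push_cast at h2
  nlinarith

theorem partitionEntropy_itinerary_zero (P : X → κ) :
    partitionEntropy μ (itinerary T P 0) = 0 := by
  have : ∀ w : Fin 0 → κ, itinerary T P 0 ⁻¹' {w} = Set.univ := fun w => by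
    ext x
    simpa using Subsingleton.elim _ _
  simp [partitionEntropy, this]

theorem partitionEntropy_itinerary_eq_sum (hT : Measurable T) {P : X → κ} (hP : Measurable P)
    (n : ℕ) : partitionEntropy μ (itinerary T P n) =
      ∑ i ∈ Finset.range n, condPartitionEntropy μ (fun x => P (T^[i] x)) (itinerary T P i) := by
  induction n with
  | zero => rw [partitionEntropy_itinerary_zero, Finset.sum_range_zero]
  | succ n ih => rw [partitionEntropy_itinerary_succ hT hP, ih, Finset.sum_range_succ]

theorem IsGenerator.measureEntropy_le_log_card [Nonempty κ] {P : X → κ} (hgen : IsGenerator T P)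
    (hT : MeasurePreserving T μ μ) (hP : Measurable P) :
    measureEntropy T μ ≤ (log (Fintype.card κ) : ℝ) := by
  refine hgen.measureEntropy_le hT hP (C := 0) fun n => ?_
  rw [partitionEntropy_itinerary_eq_sum hT.measurable hP, add_zero, mul_comm]
  refine (Finset.sum_le_card_nsmul _ _ (log (Fintype.card κ)) fun i _ => ?_).trans_eq (by simp)
  exact condPartitionEntropy_le_log_card (hP.comp (hT.measurable.iterate i))
    (measurable_itinerary hT.measurable hP i)

/-- A measure whose entropy is the logarithm of the number of symbols of a generator gives the
same mass to all cylinders of the same length. -/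
theorem IsGenerator.measureReal_cylinder [Nonempty κ] {P : X → κ} (hgen : IsGenerator T P)
    (hT : MeasurePreserving T μ μ) (hP : Measurable P)
    (h : ((log (Fintype.card κ) : ℝ) : EReal) ≤ measureEntropy T μ) (n : ℕ) (w : Fin n → κ) :
    μ.real (itinerary T P n ⁻¹' {w}) = ((Fintype.card κ : ℝ) ^ n)⁻¹ := by
  -- The entropy increments decrease, so a single one below `log (card κ)` would bound the growth
  -- rate, and hence the entropy, by a smaller number.
  have hcard : ∀ k, log (Fintype.card κ) ≤
      condPartitionEntropy μ (fun x => P (T^[k] x)) (itinerary T P k) := by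
    intro k
    by_contra! hlt
    set δ := fun i => condPartitionEntropy μ (fun x => P (T^[i] x)) (itinerary T P i) with hδ
    have hle : ∀ i, δ i ≤ log (Fintype.card κ) := fun i =>
      condPartitionEntropy_le_log_card (hP.comp (hT.measurable.iterate i))
        (measurable_itinerary hT.measurable hP i)
    have anti : Antitone δ := condPartitionEntropy_itinerary_antitone hT hP
    -- The additive constant covers the first `k` increments, which may be as large as `log (card
    -- κ)`.
    have hb : ∀ n, partitionEntropy μ (itinerary T P n) ≤
        δ k * n + k * (log (Fintype.card κ) - δ k) := by
      intro n
      rw [partitionEntropy_itinerary_eq_sum hT.measurable hP]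
      induction n with
      | zero =>
        simp only [Finset.range_zero, Finset.sum_empty, Nat.cast_zero, mul_zero, zero_add]
        exact mul_nonneg (Nat.cast_nonneg _) (sub_nonneg.2 (hle k))
      | succ n ih =>
        rw [Finset.sum_range_succ]
        by_cases hn : k ≤ n
        · have := anti hn
          push_cast
          simp only [hδ] at this ih ⊢
          linarith
        · have h1 : ∑ i ∈ Finset.range n, δ i + δ n ≤ (n + 1) * log (Fintype.card κ) := by
            rw [← Finset.sum_range_succ]
            refine (Finset.sum_le_card_nsmul _ _ _ fun i _ => hle i).trans_eq (by simp)
          have h2 : ((n + 1 : ℕ) : ℝ) ≤ k := by exact_mod_cast by omega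
          push_cast at h2 ⊢
          have h3 := mul_le_mul_of_nonneg_right h2 (sub_nonneg.2 (hle k))
          simp only [hδ] at h1 h3 ⊢
          linarith
    have := h.trans (hgen.measureEntropy_le hT hP hb)
    exact absurd hlt (not_lt.2 (by exact_mod_cast this))
  induction n with
  | zero =>
    have : itinerary T P 0 ⁻¹' {w} = Set.univ := by
      ext x
      simpa using Subsingleton.elim _ _
    simp [this]
  | succ n ih =>
    -- Maximal conditional entropy makes symbol `n` uniform and independent of the preceding ones,
    -- so each cylinder splits into parts of equal mass.
    have h1 := measureReal_inter_eq_of_log_card_le (hP.comp (hT.measurable.iterate n))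
      (measurable_itinerary hT.measurable hP n) (hcard n) (w (Fin.last n)) (fun j => w j.castSucc)
    rw [ih] at h1
    rw [pow_succ, mul_inv, ← div_eq_mul_inv, ← h1]
    congr 1
    ext x
    simp only [Set.mem_preimage, Set.mem_singleton_iff, Set.mem_inter_iff, Function.comp]
    constructor
    · rintro rfl
      exact ⟨rfl, rfl⟩
    · rintro ⟨h1, h2⟩
      funext i
      refine Fin.lastCases h1 (fun j => congrFun h2 j) i

/-- If all cylinders of the same length of a generator have the same mass, the entropy is the
logarithm of the number of symbols. -/
theorem IsGenerator.measureEntropy_eq {N : ℕ} [NeZero N] {P : X → Fin N} (hgen : IsGenerator T P)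
    (hT : MeasurePreserving T μ μ) (hP : Measurable P)
    (h : ∀ n (w : Fin n → Fin N), μ.real (itinerary T P n ⁻¹' {w}) = ((N : ℝ) ^ n)⁻¹) :
    measureEntropy T μ = (log N : ℝ) := by
  apply le_antisymm
  · simpa using hgen.measureEntropy_le_log_card hT hP
  · refine le_trans ?_ (le_iSup₂_of_le N P (le_iSup_of_le hP le_rfl))
    have hN : (N : ℝ) ≠ 0 := by exact_mod_cast NeZero.ne N
    have : ∀ᶠ n : ℕ in atTop,
        ((log N : ℝ) : EReal) = ((partitionEntropy μ (itinerary T P n) / n : ℝ) : EReal) := by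
      filter_upwards [eventually_gt_atTop 0] with n hn
      have hn : (n : ℝ) ≠ 0 := by positivity
      congr 1
      simp only [partitionEntropy, h, negMulLog, Finset.sum_const, Finset.card_univ,
        Fintype.card_fun, Fintype.card_fin, nsmul_eq_mul, Real.log_inv, Real.log_pow]
      push_cast
      field_simp
    rw [entropyOfPartition, ← limsup_congr this, limsup_const]

end Generators

/-! ### Multiplication by `N` on `ℝ / ℤ`: topological entropy and Lebesgue measure -/

section CircleExpansion

theorem UnitAddCircle.norm_coe_le (x : ℝ) : ‖(x : UnitAddCircle)‖ ≤ |x| := by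
  rw [UnitAddCircle.norm_eq]
  simpa using round_le x 0

theorem UnitAddCircle.dist_coe (x y : ℝ) :
    dist (x : UnitAddCircle) y = ‖((x - y : ℝ) : UnitAddCircle)‖ := by
  rw [dist_eq_norm, AddCircle.coe_sub]

variable (N : ℕ)

/-- Multiplication by `N` on the circle `ℝ / ℤ`. -/
def circleMul : UnitAddCircle → UnitAddCircle := fun x => N • x

theorem circleMul_iterate_coe (k : ℕ) (x : ℝ) :
    (circleMul N)^[k] (x : UnitAddCircle) = ((N ^ k * x : ℝ) : UnitAddCircle) := by
  induction k with
  | zero => simp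
  | succ k ih =>
    rw [Function.iterate_succ_apply', ih, circleMul, ← AddCircle.coe_nsmul, nsmul_eq_mul, pow_succ']
    congr 1
    ring

variable {N}

/-- Round down to the grid of mesh `N ^ -(n + M)`: after fewer than `n` steps the error has grown to
at most `N ^ -M`. -/
theorem isDynCoverOf_circleMul (hN : 2 ≤ N) {ε : ℝ} {M : ℕ} (hM : ((N : ℝ) ^ M)⁻¹ < ε)
    {U : SetRel UnitAddCircle UnitAddCircle} (hU : ∀ ⦃a b⦄, dist a b < ε → (a, b) ∈ U) (n : ℕ) :
    Dynamics.IsDynCoverOf (circleMul N) Set.univ U n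
      ((Finset.range (N ^ (n + M))).image
        fun j : ℕ => (((j : ℝ) / (N : ℝ) ^ (n + M) : ℝ) : UnitAddCircle) : Finset _) := by
  intro x _
  obtain ⟨r, ⟨hr0, hr1⟩, rfl⟩ := AddCircle.eq_coe_Ico x
  have hN0 : (0 : ℝ) < N := by positivity
  have hpow : (0 : ℝ) < (N : ℝ) ^ (n + M) := by positivity
  have hfl := Nat.floor_le (mul_nonneg hpow.le hr0)
  have hlt := Nat.lt_floor_add_one ((N : ℝ) ^ (n + M) * r)
  refine ⟨_, Finset.mem_coe.2 (Finset.mem_image_of_mem _ (a := ⌊(N : ℝ) ^ (n + M) * r⌋₊) ?_), ?_⟩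
  · rw [Finset.mem_range, Nat.floor_lt (mul_nonneg hpow.le hr0)]
    push_cast
    nlinarith
  · refine Dynamics.mem_dynEntourage.2 fun k hk => hU ?_
    rw [circleMul_iterate_coe, circleMul_iterate_coe, UnitAddCircle.dist_coe]
    refine (UnitAddCircle.norm_coe_le _).trans_lt (lt_of_le_of_lt ?_ hM)
    rw [← mul_sub, abs_mul, abs_of_pos (by positivity : (0 : ℝ) < (N : ℝ) ^ k)]
    have h1 : |r - ⌊(N : ℝ) ^ (n + M) * r⌋₊ / (N : ℝ) ^ (n + M)| ≤ ((N : ℝ) ^ (n + M))⁻¹ := by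
      rw [abs_le]
      constructor
      · have : (⌊(N : ℝ) ^ (n + M) * r⌋₊ : ℝ) / (N : ℝ) ^ (n + M) ≤ r := by
          rw [div_le_iff₀ hpow]; linarith
        have := inv_nonneg.2 hpow.le
        linarith
      · rw [sub_le_iff_le_add, inv_eq_one_div, ← add_div, le_div_iff₀ hpow]
        linarith
    calc (N : ℝ) ^ k * _ ≤ (N : ℝ) ^ n * ((N : ℝ) ^ (n + M))⁻¹ := by
          gcongr
          exact_mod_cast by omega
      _ = ((N : ℝ) ^ M)⁻¹ := by
          rw [pow_add, mul_inv, mul_inv_cancel_left₀ (by positivity)]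

/-- Powers of `N` are shown to divide `m` one at a time: if `m = N ^ l * q`, step `n - 1 - l`
reaches `q / N`, and being within less than `1 / N` of an integer forces `N ∣ q`. -/
theorem eq_zero_of_norm_coe_lt (hN : 2 ≤ N) {n : ℕ} {m : ℤ} (hm : |m| < (N : ℤ) ^ n)
    (h : ∀ k < n, ‖(((N : ℝ) ^ k * (m / (N : ℝ) ^ n) : ℝ) : UnitAddCircle)‖ < (N : ℝ)⁻¹) :
    m = 0 := by
  have hN0 : (0 : ℝ) < N := by positivity
  have key : ∀ l ≤ n, (N : ℤ) ^ l ∣ m := by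
    intro l
    induction l with
    | zero => simp
    | succ l ih =>
      intro hl
      obtain ⟨q, hq⟩ := ih (by omega)
      have h1 := h (n - 1 - l) (by omega)
      have h2 : (N : ℝ) ^ (n - 1 - l) * (m / (N : ℝ) ^ n) = q / N := by
        rw [hq]
        push_cast
        have : (N : ℝ) ^ n = (N : ℝ) ^ (n - 1 - l) * (N : ℝ) ^ l * N := by
          rw [← pow_add, ← pow_succ]
          congr 1
          omega
        rw [this]
        field_simp
      rw [h2, UnitAddCircle.norm_eq] at h1
      set z := round ((q : ℝ) / N)
      have h3 : |(q : ℝ) - N * z| < 1 := by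
        have : (q : ℝ) - N * z = N * (q / N - z) := by field_simp
        rw [this, abs_mul, abs_of_pos hN0]
        calc (N : ℝ) * _ < N * (N : ℝ)⁻¹ := by gcongr
          _ = 1 := mul_inv_cancel₀ hN0.ne'
      have h4 : |q - N * z| < 1 := by exact_mod_cast h3
      rw [Int.abs_lt_one_iff, sub_eq_zero] at h4
      exact ⟨z, by rw [hq, h4]; ring⟩
  exact Int.eq_zero_of_abs_lt_dvd (key n le_rfl) hm

/-- If two dynamical balls of radius `1 / (2 N)` meet, their centres stay less than `1 / N` apart
for `n` steps, so these grid points coincide. -/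
theorem isDynNetIn_circleMul (hN : 2 ≤ N) (n : ℕ) :
    Dynamics.IsDynNetIn (circleMul N) Set.univ {p | dist p.1 p.2 < (2 * N : ℝ)⁻¹} n
      ((Finset.range (N ^ n)).image
        fun j : ℕ => (((j : ℝ) / (N : ℝ) ^ n : ℝ) : UnitAddCircle) : Finset _) := by
  refine ⟨Set.subset_univ _, ?_⟩
  rintro x hx y hy hxy
  rw [Finset.coe_image] at hx hy
  obtain ⟨i, hi, rfl⟩ := hx
  obtain ⟨j, hj, rfl⟩ := hy
  simp only [Finset.coe_range, Set.mem_Iio] at hi hj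
  refine Set.disjoint_left.2 fun z hz1 hz2 => hxy ?_
  have h0 : ((i : ℤ) - j) = 0 := by
    refine eq_zero_of_norm_coe_lt hN (n := n) ?_ fun k hk => ?_
    · have : (i : ℤ) < (N : ℤ) ^ n := by exact_mod_cast hi
      have : (j : ℤ) < (N : ℤ) ^ n := by exact_mod_cast hj
      rw [abs_lt]
      constructor <;> omega
    · have h1 := Dynamics.mem_ball_dynEntourage.1 hz1 k hk
      have h2 := Dynamics.mem_ball_dynEntourage.1 hz2 k hk
      replace h1 : dist _ _ < _ := h1
      replace h2 : dist _ _ < _ := h2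
      have h3 := dist_triangle_right ((circleMul N)^[k] ((i / (N : ℝ) ^ n : ℝ) : UnitAddCircle))
        ((circleMul N)^[k] ((j / (N : ℝ) ^ n : ℝ) : UnitAddCircle)) ((circleMul N)^[k] z)
      rw [circleMul_iterate_coe, circleMul_iterate_coe, UnitAddCircle.dist_coe, ← mul_sub,
        ← sub_div] at h3
      rw [circleMul_iterate_coe] at h1 h2
      push_cast
      have h4 : (N : ℝ)⁻¹ = (2 * N : ℝ)⁻¹ + (2 * N : ℝ)⁻¹ := by
        rw [mul_inv]; ring
      linarith
  have : i = j := by omega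
  rw [this]

theorem card_image_circle (hN : 2 ≤ N) (n : ℕ) :
    ((Finset.range (N ^ n)).image
      fun j : ℕ => (((j : ℝ) / (N : ℝ) ^ n : ℝ) : UnitAddCircle)).card = N ^ n := by
  have hN0 : (0 : ℝ) < N := by positivity
  rw [Finset.card_image_of_injOn, Finset.card_range]
  intro i hi j hj hij
  simp only [Finset.coe_range, Set.mem_Iio] at hi hj
  have hmem : ∀ k : ℕ, k < N ^ n → (k : ℝ) / (N : ℝ) ^ n ∈ Set.Ico (0 : ℝ) (0 + 1) := by
    intro k hk
    refine ⟨by positivity, ?_⟩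
    rw [zero_add, div_lt_one (by positivity)]
    exact_mod_cast hk
  have := (AddCircle.coe_eq_coe_iff_of_mem_Ico (hmem i hi) (hmem j hj)).1 hij
  rw [div_left_inj' (by positivity)] at this
  exact_mod_cast this

/-- Covers need at most `N ^ (n + M)` points with `M` depending only on the entourage, and nets have
at least `N ^ n` points; the factor `N ^ M` does not affect the growth rate. -/
theorem coverEntropy_circleMul (hN : 2 ≤ N) :
    Dynamics.coverEntropy (circleMul N) Set.univ = (log N : ℝ) := by
  have hN0 : (0 : ℝ) < N := by positivity
  have hlog : ((log N : ℝ) : EReal) = ENNReal.log (N : ENNReal) := by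
    rw [← ENNReal.ofReal_natCast, ENNReal.log_ofReal_of_pos hN0]
  rw [hlog, ← ExpGrowth.expGrowthSup_pow]
  apply le_antisymm
  · refine iSup₂_le fun U hU => ?_
    obtain ⟨ε, hε, hεU⟩ := Metric.mem_uniformity_dist.1 hU
    obtain ⟨M, hM⟩ : ∃ M : ℕ, ((N : ℝ) ^ M)⁻¹ < ε := by
      obtain ⟨M, hM⟩ := exists_pow_lt_of_lt_one hε
        (inv_lt_one_of_one_lt₀ (by exact_mod_cast hN : (1 : ℝ) < N))
      exact ⟨M, by rwa [inv_pow] at hM⟩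
    refine ExpGrowth.expGrowthSup_le_of_eventually_le (b := (N : ENNReal) ^ M)
      (ENNReal.pow_ne_top (ENNReal.natCast_ne_top N)) (Eventually.of_forall fun n => ?_)
    have := (isDynCoverOf_circleMul hN hM hεU n).coverMincard_le_card
    rw [card_image_circle hN] at this
    have := ENat.toENNReal_le.2 this
    refine this.trans_eq ?_
    push_cast
    rw [← pow_add, add_comm]
  · refine le_trans ?_ (Dynamics.netEntropyEntourage_le_coverEntropy _ _
      (Metric.dist_mem_uniformity (by positivity : (0 : ℝ) < (2 * N : ℝ)⁻¹)))
    refine ExpGrowth.expGrowthSup_monotone fun n => ?_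
    have := (isDynNetIn_circleMul hN n).card_le_netMaxcard
    rw [card_image_circle hN] at this
    have := ENat.toENNReal_le.2 this
    refine le_trans (le_of_eq ?_) this
    push_cast
    rfl

theorem measurePreserving_circleMul (hN : 2 ≤ N) :
    MeasurePreserving (circleMul N) (volume : Measure UnitAddCircle) volume :=
  (AddCircle.ergodic_nsmul (T := 1) (n := N) (by omega)).toMeasurePreserving

theorem measurable_circleMul : Measurable (circleMul N) := (continuous_nsmul N).measurable

/-- Points with the same image differ by an element of the finite `N`-torsion subgroup, so the set
is covered by finitely many translates of `E`. This is the source of quasi-invariance on inverse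
branches. -/
theorem volume_preimage_image_circleMul (hN : 2 ≤ N) {E : Set UnitAddCircle}
    (hE : (volume : Measure UnitAddCircle) E = 0) :
    (volume : Measure UnitAddCircle) (circleMul N ⁻¹' (circleMul N '' E)) = 0 := by
  have hfin := AddCircle.finite_torsion (p := (1 : ℝ)) (n := N) (by omega)
  refine measure_mono_null (t := ⋃ c ∈ {u : UnitAddCircle | N • u = 0}, (· + c) ⁻¹' E) ?_ ?_
  · rintro x ⟨y, hy, hyx⟩
    simp only [Set.mem_iUnion]
    refine ⟨y - x, ?_, ?_⟩
    · change N • (y - x) = 0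
      rw [nsmul_sub, sub_eq_zero]
      exact hyx
    · change x + (y - x) ∈ E
      rwa [add_sub_cancel]
  · rw [measure_biUnion_null_iff hfin.countable]
    intro c _
    rw [measure_preimage_add_right, hE]

/-- The representative in `[0, 1)` of a point of the circle. -/
noncomputable def circleRep (x : UnitAddCircle) : ℝ := (AddCircle.equivIco 1 0 x : ℝ)

theorem circleRep_mem (x : UnitAddCircle) : circleRep x ∈ Set.Ico (0 : ℝ) 1 := by
  obtain ⟨h0, h1⟩ := (AddCircle.equivIco 1 0 x).2
  exact ⟨h0, h1.trans_eq (zero_add 1)⟩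

theorem coe_circleRep (x : UnitAddCircle) : (circleRep x : UnitAddCircle) = x :=
  AddCircle.coe_equivIco

theorem circleRep_coe (y : ℝ) : circleRep (y : UnitAddCircle) = Int.fract y := by
  refine (AddCircle.coe_equivIco_mk_apply (p := (1 : ℝ)) y).trans ?_
  rw [div_one, mul_one]

theorem measurable_circleRep : Measurable circleRep :=
  measurable_subtype_coe.comp (AddCircle.measurableEquivIco 1 0).measurable

/-- The first base `N` digit of a point of the circle. -/
noncomputable def circleDigit (N : ℕ) [NeZero N] (x : UnitAddCircle) : Fin N :=
  ⟨⌊N * circleRep x⌋₊, by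
    have hN : (0 : ℝ) < N := by exact_mod_cast Nat.pos_of_ne_zero (NeZero.ne N)
    rw [Nat.floor_lt (mul_nonneg hN.le (circleRep_mem x).1)]
    nlinarith [(circleRep_mem x).2]⟩

variable [NeZero N]

theorem circleDigit_eq_iff (x : UnitAddCircle) (i : Fin N) :
    circleDigit N x = i ↔ (i : ℝ) ≤ N * circleRep x ∧ N * circleRep x < i + 1 := by
  rw [Fin.ext_iff]
  exact Nat.floor_eq_iff (mul_nonneg (Nat.cast_nonneg _) (circleRep_mem x).1)

theorem measurable_circleDigit : Measurable (circleDigit N) := by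
  refine measurable_to_countable' fun i => ?_
  have : circleDigit N ⁻¹' {i} = (fun x => ⌊N * circleRep x⌋₊) ⁻¹' {(i : ℕ)} := by
    ext x
    simp [circleDigit, Fin.ext_iff]
  rw [this]
  exact (Nat.measurable_floor.comp (measurable_const.mul measurable_circleRep))
    (measurableSet_singleton _)

theorem circleDigit_add_circleRep (x : UnitAddCircle) :
    N * circleRep x = (circleDigit N x : ℕ) + circleRep (circleMul N x) := by
  have h : circleMul N x = ((N * circleRep x : ℝ) : UnitAddCircle) := by
    conv_lhs => rw [← coe_circleRep x]
    rw [circleMul, ← AddCircle.coe_nsmul, nsmul_eq_mul]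
  rw [h, circleRep_coe, circleDigit]
  have h0 : 0 ≤ N * circleRep x := mul_nonneg (Nat.cast_nonneg _) (circleRep_mem x).1
  rw [natCast_floor_eq_intCast_floor h0, Int.floor_add_fract]

/-- While the digits agree, each step multiplies the difference of representatives by `N`; it always
stays below 1 in absolute value, so it is zero. -/
theorem circleDigits_injective (hN : 2 ≤ N) :
    Function.Injective fun (x : UnitAddCircle) (n : ℕ) => circleDigit N ((circleMul N)^[n] x) := by
  intro x y hxy
  have hN1 : (1 : ℝ) < N := by exact_mod_cast hN
  have key : ∀ n : ℕ, (N : ℝ) ^ n * (circleRep x - circleRep y) =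
      circleRep ((circleMul N)^[n] x) - circleRep ((circleMul N)^[n] y) := by
    intro n
    induction n with
    | zero => simp
    | succ n ih =>
      rw [pow_succ', mul_assoc, ih, mul_sub, circleDigit_add_circleRep,
        circleDigit_add_circleRep, ← Function.iterate_succ_apply' (circleMul N),
        ← Function.iterate_succ_apply' (circleMul N)]
      have := congrFun hxy n
      simp only at this
      rw [this]
      ring
  have h0 : circleRep x - circleRep y = 0 := by
    by_contra h
    obtain ⟨n, hn⟩ := pow_unbounded_of_one_lt |circleRep x - circleRep y|⁻¹ hN1
    have h1 := congrArg abs (key n)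
    have h2 : |circleRep ((circleMul N)^[n] x) - circleRep ((circleMul N)^[n] y)| < 1 := by
      have a := circleRep_mem ((circleMul N)^[n] x)
      have b := circleRep_mem ((circleMul N)^[n] y)
      rw [abs_lt]
      constructor <;> linarith [a.1, a.2, b.1, b.2]
    rw [abs_mul, abs_of_pos (by positivity : (0 : ℝ) < (N : ℝ) ^ n)] at h1
    have h3 : 0 < |circleRep x - circleRep y| := abs_pos.2 h
    rw [inv_lt_iff_one_lt_mul₀ h3] at hn
    linarith
  rw [← coe_circleRep x, ← coe_circleRep y, sub_eq_zero.1 h0]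

/-- An injective measurable map between standard Borel spaces is a measurable embedding, so the
digit sequence generates the Borel sets. -/
theorem isGenerator_circleDigit (hN : 2 ≤ N) : IsGenerator (circleMul N) (circleDigit N) := by
  have hm : Measurable fun (x : UnitAddCircle) (n : ℕ) => circleDigit N ((circleMul N)^[n] x) :=
    measurable_pi_iff.2 fun n => measurable_circleDigit.comp (measurable_circleMul.iterate n)
  exact (hm.measurableEmbedding (circleDigits_injective hN)).comap_eq.ge

/-- Translation by the torsion element `(j - i) / N` carries the piece with digit `i` into the piece
with digit `j`. Hence the `N` pieces have equal mass, and invariance gives their sum. -/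
theorem volume_circleDigit_inter (hN : 2 ≤ N) {E : Set UnitAddCircle} (hE : MeasurableSet E)
    (i : Fin N) :
    (volume : Measure UnitAddCircle).real (circleMul N ⁻¹' E ∩ circleDigit N ⁻¹' {i}) =
      (volume : Measure UnitAddCircle).real E / N := by
  have hN0 : (0 : ℝ) < N := by positivity
  have hle : ∀ i j : Fin N,
      (volume : Measure UnitAddCircle).real (circleMul N ⁻¹' E ∩ circleDigit N ⁻¹' {i}) ≤
      (volume : Measure UnitAddCircle).real (circleMul N ⁻¹' E ∩ circleDigit N ⁻¹' {j}) := by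
    intro i j
    set τ : UnitAddCircle := ((((j : ℝ) - i) / N : ℝ) : UnitAddCircle)
    have hτ : circleMul N τ = 0 := by
      rw [circleMul, ← AddCircle.coe_nsmul, nsmul_eq_mul, mul_div_cancel₀ _ hN0.ne',
        AddCircle.coe_eq_zero_iff]
      exact ⟨(j : ℤ) - i, by simp⟩
    have hmeas : MeasurableSet (circleMul N ⁻¹' E ∩ circleDigit N ⁻¹' {j}) :=
      (measurable_circleMul hE).inter (measurable_circleDigit (measurableSet_singleton _))
    rw [← (measurePreserving_add_right (volume : Measure UnitAddCircle) τ).measureReal_preimage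
      hmeas.nullMeasurableSet]
    refine measureReal_mono fun x hx => ?_
    obtain ⟨hx1, hx2⟩ := hx
    refine ⟨?_, ?_⟩
    · change circleMul N (x + τ) ∈ E
      have : circleMul N (x + τ) = circleMul N x + circleMul N τ := nsmul_add _ _ _
      rw [this, hτ, add_zero]
      exact hx1
    · change circleDigit N (x + τ) = j
      replace hx2 : circleDigit N x = i := hx2
      rw [circleDigit_eq_iff] at hx2 ⊢
      have hj : (j : ℝ) + 1 ≤ N := by exact_mod_cast j.2
      have hrep : circleRep (x + τ) = circleRep x + ((j : ℝ) - i) / N := by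
        have h1 : x + τ = ((circleRep x + ((j : ℝ) - i) / N : ℝ) : UnitAddCircle) := by
          rw [AddCircle.coe_add, coe_circleRep]
        have h2 : circleRep x + ((j : ℝ) - i) / N = (N * circleRep x + (j - i)) / N := by
          field_simp
        rw [h1, circleRep_coe, Int.fract_eq_self, h2]
        constructor
        · apply div_nonneg _ hN0.le
          have : (0 : ℝ) ≤ (j : ℕ) := Nat.cast_nonneg _
          linarith [hx2.1]
        · rw [div_lt_one hN0]
          linarith [hx2.2]
      rw [hrep, mul_add, mul_div_cancel₀ _ hN0.ne']
      constructor <;> linarith [hx2.1, hx2.2]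
  have hsum := sum_measureReal_inter_fiber (μ := (volume : Measure UnitAddCircle))
    (measurable_circleDigit (N := N)) (circleMul N ⁻¹' E)
  rw [(measurePreserving_circleMul hN).measureReal_preimage hE.nullMeasurableSet,
    Finset.sum_congr rfl fun j _ => le_antisymm (hle j i) (hle i j)] at hsum
  rw [Finset.sum_const, Finset.card_univ, Fintype.card_fin, nsmul_eq_mul] at hsum
  rw [eq_div_iff hN0.ne', mul_comm]
  exact hsum

theorem volume_cylinder_circle (hN : 2 ≤ N) (n : ℕ) (w : Fin n → Fin N) :
    (volume : Measure UnitAddCircle).real (itinerary (circleMul N) (circleDigit N) n ⁻¹' {w}) =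
      ((N : ℝ) ^ n)⁻¹ := by
  induction n with
  | zero =>
    have : itinerary (circleMul N) (circleDigit N) 0 ⁻¹' {w} = Set.univ := by
      ext x
      simpa using Subsingleton.elim _ _
    rw [this, measureReal_def, UnitAddCircle.measure_univ]
    simp
  | succ n ih =>
    have h1 : itinerary (circleMul N) (circleDigit N) (n + 1) ⁻¹' {w} =
        circleMul N ⁻¹' (itinerary (circleMul N) (circleDigit N) n ⁻¹' {fun j => w j.succ}) ∩
          circleDigit N ⁻¹' {w 0} := by
      ext x
      simp only [Set.mem_preimage, Set.mem_singleton_iff, Set.mem_inter_iff]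
      constructor
      · rintro rfl
        exact ⟨rfl, rfl⟩
      · rintro ⟨h1, h2⟩
        funext i
        refine Fin.cases h2 (fun j => congrFun h1 j) i
    rw [h1, volume_circleDigit_inter hN (measurable_itinerary measurable_circleMul
      measurable_circleDigit n (measurableSet_singleton _)), ih, pow_succ, mul_inv, div_eq_mul_inv]

instance isProbabilityMeasure_volume_unitAddCircle :
    IsProbabilityMeasure (volume : Measure UnitAddCircle) := ⟨UnitAddCircle.measure_univ⟩

/-- Lebesgue measure is the unique measure of maximal entropy of multiplication by `N`. -/
theorem isMME_circleMul_iff (hN : 2 ≤ N) {μ : Measure UnitAddCircle} :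
    IsMME (circleMul N) μ ↔ μ = volume := by
  have hgen := isGenerator_circleDigit hN
  constructor
  · rintro ⟨h1, h2, h3⟩
    rw [coverEntropy_circleMul hN] at h3
    refine hgen.measure_eq measurable_circleMul measurable_circleDigit fun n w => ?_
    rw [volume_cylinder_circle hN,
      hgen.measureReal_cylinder h2 measurable_circleDigit (by simpa using h3.ge)]
    simp
  · rintro rfl
    refine ⟨inferInstance, measurePreserving_circleMul hN, ?_⟩
    rw [coverEntropy_circleMul hN]
    exact hgen.measureEntropy_eq (measurePreserving_circleMul hN) measurable_circleDigit
      (volume_cylinder_circle hN)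

end CircleExpansion

/-! ### Transport by conjugacy and linearization of expanding circle maps -/

section Conjugacy

theorem measureEntropy_le_map {X Y : Type*} [MeasurableSpace X] [MeasurableSpace Y] (φ : X ≃ᵐ Y)
    {S : X → X} {T : Y → Y} (h : Function.Semiconj φ S T) (μ : Measure X) :
    measureEntropy S μ ≤ measureEntropy T (μ.map φ) := by
  refine iSup_le fun k => iSup_le fun ξ => iSup_le fun hξ => ?_
  refine le_trans (le_of_eq ?_)
    (le_iSup₂_of_le k (ξ ∘ φ.symm) (le_iSup_of_le (hξ.comp φ.symm.measurable) le_rfl))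
  unfold entropyOfPartition
  congr 1
  funext n
  congr 2
  unfold partitionEntropy
  refine Finset.sum_congr rfl fun w _ => ?_
  rw [measureReal_def, measureReal_def, φ.map_apply]
  congr 3
  ext x
  simp only [Set.mem_preimage, Set.mem_singleton_iff]
  have : itinerary T (ξ ∘ φ.symm) n (φ x) = itinerary S ξ n x := by
    funext i
    simp only [itinerary, Function.comp]
    rw [← (h.iterate_right i).eq x, φ.symm_apply_apply]
  rw [this]

/-- Measures of maximal entropy are transported by topological conjugacies. -/
theorem IsMME.map_homeomorph {X Y : Type*} [UniformSpace X] [CompactSpace X] [MeasurableSpace X]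
    [BorelSpace X] [UniformSpace Y] [CompactSpace Y] [MeasurableSpace Y] [BorelSpace Y]
    (φ : X ≃ₜ Y) {S : X → X} {T : Y → Y} (h : Function.Semiconj φ S T) {μ : Measure X}
    (hμ : IsMME S μ) : IsMME T (μ.map φ) := by
  have := hμ.isProbabilityMeasure
  have h' : Function.Semiconj φ.symm T S := fun y => by
    apply φ.injective
    rw [φ.apply_symm_apply, h.eq, φ.apply_symm_apply]
  refine ⟨Measure.isProbabilityMeasure_map φ.measurable.aemeasurable, ?_, ?_⟩
  · have hT : T = φ ∘ S ∘ φ.symm := by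
      funext y
      simp only [Function.comp]
      rw [h.eq, φ.apply_symm_apply]
    have hS := hμ.measurePreserving
    refine ⟨?_, ?_⟩
    · rw [hT]
      exact φ.measurable.comp (hS.measurable.comp φ.symm.measurable)
    · have hφT : T ∘ φ = φ ∘ S := funext fun x => (h.eq x).symm
      have hTm : Measurable T := by
        rw [hT]
        exact φ.measurable.comp (hS.measurable.comp φ.symm.measurable)
      rw [Measure.map_map hTm φ.measurable, hφT, ← Measure.map_map φ.measurable hS.measurable,
        hS.map_eq]
  · have e1 : measureEntropy T (μ.map φ) = measureEntropy S μ := by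
      apply le_antisymm
      · refine (measureEntropy_le_map φ.symm.toMeasurableEquiv h' (μ.map φ)).trans_eq ?_
        congr 1
        have : (μ.map φ).map φ.symm = μ := by
          rw [Measure.map_map φ.symm.measurable φ.measurable]
          simp
        exact this
      · exact measureEntropy_le_map φ.toMeasurableEquiv h μ
    rw [e1, hμ.entropy_eq]
    apply le_antisymm
    · have := Dynamics.coverEntropy_image_le_of_uniformContinuous h'
        (CompactSpace.uniformContinuous_of_continuous φ.symm.continuous) Set.univ
      rwa [Set.image_univ, φ.symm.surjective.range_eq] at this
    · have := Dynamics.coverEntropy_image_le_of_uniformContinuous h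
        (CompactSpace.uniformContinuous_of_continuous φ.continuous) Set.univ
      rwa [Set.image_univ, φ.surjective.range_eq] at this

theorem exists_forall_abs_le_of_periodic {φ : ℝ → ℝ} (hc : Continuous φ)
    (hp : Function.Periodic φ 1) : ∃ K, ∀ x, |φ x| ≤ K := by
  obtain ⟨K, hK⟩ := (isCompact_Icc (a := (0 : ℝ)) (b := 1)).exists_bound_of_continuousOn
    hc.continuousOn
  refine ⟨K, fun x => ?_⟩
  obtain ⟨y, hy, hxy⟩ := hp.exists_mem_Ico₀ one_pos x
  rw [hxy]
  exact hK y ⟨hy.1, hy.2.le⟩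

theorem exists_abs_sub_self_le {g : ℝ → ℝ} (hc : Continuous g) (hg : ∀ x, g (x + 1) = g x + 1) :
    ∃ C, ∀ x, |g x - x| ≤ C :=
  exists_forall_abs_le_of_periodic (φ := fun x => g x - x) (by fun_prop) fun x => by
    simp only
    rw [hg]
    ring

theorem surjective_of_add_one {g : ℝ → ℝ} (hc : Continuous g) (hg : ∀ x, g (x + 1) = g x + 1) :
    Function.Surjective g := by
  obtain ⟨C, hC⟩ := exists_abs_sub_self_le hc hg
  refine hc.surjective ?_ ?_
  · exact tendsto_atTop_mono (f := fun x => x + -C)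
      (fun x => by linarith [(abs_le.1 (hC x)).1])
      (tendsto_atTop_add_const_right _ (-C) tendsto_id)
  · exact tendsto_atBot_mono
      (fun x => show g x ≤ x + C by linarith [(abs_le.1 (hC x)).2])
      (tendsto_atBot_add_const_right _ C tendsto_id)

/-- Iterates of an expanding lift of a circle map separate distinct points arbitrarily far. -/
theorem exists_lt_iterate_sub_iterate {f : ℝ → ℝ} {N : ℕ} (hc : Continuous f)
    (hper : ∀ x, f (x + 1) = f x + N) (hexp : ∀ x y, x < y → y - x < f y - f x)
    {x y : ℝ} (hxy : x < y) (B : ℝ) : ∃ n, B < f^[n] y - f^[n] x := by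
  by_contra! hB
  set l : ℕ → ℝ := fun n => f^[n] y - f^[n] x with hl
  have hl0 : ∀ n, y - x ≤ l n := by
    intro n
    induction n with
    | zero => simp [hl]
    | succ n ih =>
      have : f^[n] x < f^[n] y := by
        have := sub_pos.2 hxy
        simp only [hl] at ih
        linarith
      have := hexp _ _ this
      simp only [hl] at ih ⊢
      rw [Function.iterate_succ_apply', Function.iterate_succ_apply']
      linarith
  -- The growth of a gap `p.2` based at `p.1`. Expansion need not be uniform for tiny gaps, but gaps
  -- here stay in `[y - x, B]`. Periodicity in the base point then makes the domain compact, and the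
  -- growth has a positive minimum.
  set g : ℝ × ℝ → ℝ := fun p => f (p.1 + p.2) - f p.1 - p.2 with hg
  have hgc : Continuous g := by fun_prop
  have hper' : ∀ b, Function.Periodic (fun a => g (a, b)) 1 := fun b a => by
    simp only [hg]
    rw [add_right_comm, hper, hper]
    ring
  obtain ⟨p, hp, hmin⟩ := ((isCompact_Icc (a := (0 : ℝ)) (b := 1)).prod
    (isCompact_Icc (a := y - x) (b := B))).exists_isMinOn
    ⟨(0, y - x), ⟨by simp, by simp⟩, ⟨le_rfl, (hl0 0).trans (hB 0)⟩⟩ hgc.continuousOn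
  have hm : 0 < g p := by
    have h1 : 0 < p.2 := (sub_pos.2 hxy).trans_le hp.2.1
    have := hexp p.1 (p.1 + p.2) (by linarith)
    simp only [hg]
    linarith
  have hstep : ∀ n, l n + g p ≤ l (n + 1) := by
    intro n
    obtain ⟨a, ha, hag⟩ := (hper' (l n)).exists_mem_Ico₀ one_pos (f^[n] x)
    have h1 : g p ≤ g (a, l n) := hmin ⟨⟨ha.1, ha.2.le⟩, ⟨hl0 n, hB n⟩⟩
    rw [← hag] at h1
    have h2 : l (n + 1) = g (f^[n] x, l n) + l n := by
      simp only [hg, hl, Function.iterate_succ_apply', add_sub_cancel]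
      ring
    linarith
  have hlin : ∀ n : ℕ, n * g p ≤ l n := by
    intro n
    induction n with
    | zero => simpa using (sub_pos.2 hxy).le.trans (hl0 0)
    | succ n ih =>
      have := hstep n
      push_cast
      linarith
  obtain ⟨n, hn⟩ := exists_nat_gt (B / g p)
  rw [div_lt_iff₀ hm] at hn
  linarith [hlin n, hB n]

/-- An expanding lift of degree `N` is semiconjugate to multiplication by `N` on the line. -/
theorem exists_linearization {f : ℝ → ℝ} {N : ℕ} (hN : 2 ≤ N) (hc : Continuous f)
    (hper : ∀ x, f (x + 1) = f x + N) (hexp : ∀ x y, x < y → y - x < f y - f x) :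
    ∃ h : ℝ → ℝ, Continuous h ∧ StrictMono h ∧ (∀ x, h (x + 1) = h x + 1) ∧
      ∀ x, h (f x) = N * h x := by
  have hN0 : (0 : ℝ) < N := by positivity
  have hN1 : (1 : ℝ) < N := by exact_mod_cast hN
  set φ : ℝ → ℝ := fun x => f x - N * x with hφ
  have hφc : Continuous φ := by fun_prop
  have hφp : Function.Periodic φ 1 := fun x => by
    simp only [hφ]
    rw [hper]
    ring
  obtain ⟨K, hK⟩ := exists_forall_abs_le_of_periodic hφc hφp
  have hbound : ∀ (n : ℕ) x, ‖φ (f^[n] x) / (N : ℝ) ^ (n + 1)‖ ≤ K / N * (N : ℝ)⁻¹ ^ n := by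
    intro n x
    rw [Real.norm_eq_abs, abs_div, abs_of_pos (by positivity : (0 : ℝ) < (N : ℝ) ^ (n + 1)),
      pow_succ', inv_pow, div_mul_eq_div_div_swap, div_mul_eq_mul_div, ← div_eq_mul_inv]
    gcongr
    exact hK _
  have hsum : Summable fun n : ℕ => K / N * (N : ℝ)⁻¹ ^ n :=
    (summable_geometric_of_lt_one (by positivity) (inv_lt_one_of_one_lt₀ hN1)).mul_left _
  have hs : ∀ x, Summable fun n : ℕ => φ (f^[n] x) / (N : ℝ) ^ (n + 1) := fun x =>
    Summable.of_norm_bounded hsum fun n => hbound n x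
  -- The telescoped form of `lim f^[n] x / N ^ n`, which converges uniformly because `f x - N * x`
  -- is bounded.
  set h : ℝ → ℝ := fun x => x + ∑' n : ℕ, φ (f^[n] x) / (N : ℝ) ^ (n + 1) with hh
  have hhc : Continuous h := continuous_id.add
    (continuous_tsum (fun n => (hφc.comp (hc.iterate n)).div_const _) hsum hbound)
  have hiter : ∀ (n : ℕ) x, f^[n] (x + 1) = f^[n] x + (N ^ n : ℕ) := by
    have hnat : ∀ (m : ℕ) x, f (x + m) = f x + N * m := by
      intro m x
      induction m with
      | zero => simp
      | succ m ih =>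
        push_cast
        rw [← add_assoc, hper, ih]
        ring
    intro n x
    induction n with
    | zero => simp
    | succ n ih =>
      rw [Function.iterate_succ_apply', ih, hnat, Function.iterate_succ_apply']
      push_cast
      ring
  have hhp : ∀ x, h (x + 1) = h x + 1 := fun x => by
    simp only [hh, hiter]
    have : ∀ (y : ℝ) (m : ℕ), φ (y + m) = φ y := fun y m => by
      simpa using (hφp.nat_mul m) y
    simp only [this]
    ring
  have hhf : ∀ x, h (f x) = N * h x := fun x => by
    simp only [hh]
    rw [(hs x).tsum_eq_zero_add, mul_add, mul_add, ← tsum_mul_left]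
    have h1 : ∀ n : ℕ, N * (φ (f^[n + 1] x) / (N : ℝ) ^ (n + 1 + 1)) =
        φ (f^[n] (f x)) / (N : ℝ) ^ (n + 1) := fun n => by
      rw [Function.iterate_succ_apply, pow_succ' _ (n + 1)]
      field_simp
    simp only [h1, Function.iterate_zero, id, zero_add, pow_one]
    rw [mul_div_cancel₀ _ hN0.ne']
    simp only [hφ]
    ring
  refine ⟨h, hhc, fun x y hxy => ?_, hhp, hhf⟩
  -- `h` stays within `C` of the identity, so it strictly orders points more than `2 * C` apart.
  -- Iterates of `x` and `y` reach that separation, and dividing by `N ^ n` returns to `x` and `y`.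
  obtain ⟨C, hC⟩ := exists_abs_sub_self_le hhc hhp
  obtain ⟨n, hn⟩ := exists_lt_iterate_sub_iterate hc hper hexp hxy (2 * C)
  have hpow : ∀ x, h (f^[n] x) = (N : ℝ) ^ n * h x := fun x => by
    clear hn
    induction n with
    | zero => simp
    | succ n ih => rw [Function.iterate_succ_apply', hhf, ih, pow_succ', mul_assoc]
  have h1 := abs_le.1 (hC (f^[n] x))
  have h2 := abs_le.1 (hC (f^[n] y))
  rw [hpow] at h1 h2
  have h3 : (N : ℝ) ^ n * h x < (N : ℝ) ^ n * h y := by linarith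
  exact lt_of_mul_lt_mul_left h3 (by positivity)

theorem exists_homeomorph_of_lift {g : ℝ → ℝ} (hc : Continuous g) (hmono : StrictMono g)
    (hg : ∀ x, g (x + 1) = g x + 1) :
    ∃ Φ : UnitAddCircle ≃ₜ Circle, ∀ x : ℝ, Φ (x : UnitAddCircle) = Circle.exp (2 * π * g x) := by
  have hp : Function.Periodic (fun x => Circle.exp (2 * π * g x)) 1 := fun x => by
    simp only
    rw [hg, mul_add, mul_one, Circle.exp_add, Circle.exp_two_pi, mul_one]
  have hgint : ∀ (m : ℤ) x, g (x + m) = g x + m := by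
    have : Function.Periodic (fun x => g x - x) 1 := fun x => by
      simp only
      rw [hg]
      ring
    intro m x
    have := (this.int_mul m) x
    simp only [mul_one] at this
    linarith
  set Ψ : UnitAddCircle → Circle := hp.lift with hΨ
  have hΨc : Continuous Ψ :=
    (QuotientAddGroup.isOpenQuotientMap_mk.isQuotientMap.continuous_iff).2
      (Circle.exp.continuous.comp (continuous_const.mul hc))
  have hsurj : Function.Surjective g := surjective_of_add_one hc hg
  have hbij : Function.Bijective Ψ := by
    constructor
    · intro a b hab
      obtain ⟨x, rfl⟩ := QuotientAddGroup.mk_surjective a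
      obtain ⟨y, rfl⟩ := QuotientAddGroup.mk_surjective b
      replace hab : Circle.exp (2 * π * g x) = Circle.exp (2 * π * g y) := hab
      obtain ⟨m, hm⟩ := Circle.exp_eq_exp.1 hab
      have h1 : g x = g (y + m) := by
        rw [hgint]
        have : 2 * π * g x = 2 * π * (g y + m) := by rw [hm]; ring
        exact mul_left_cancel₀ (by positivity) this
      have h2 := hmono.injective h1
      rw [h2]
      change ((y + m : ℝ) : UnitAddCircle) = (y : UnitAddCircle)
      rw [AddCircle.coe_add, add_eq_left, AddCircle.coe_eq_zero_iff]
      exact ⟨m, by simp⟩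
    · intro z
      obtain ⟨x, hx⟩ := hsurj (Complex.arg z / (2 * π))
      refine ⟨(x : UnitAddCircle), ?_⟩
      change Circle.exp (2 * π * g x) = z
      rw [hx, mul_div_cancel₀ _ (by positivity), Circle.exp_arg]
  exact ⟨Continuous.homeoOfEquivCompactToT2 (f := Equiv.ofBijective Ψ hbij) hΨc, fun x => rfl⟩

/-- A circle map with an expanding lift of degree `N` is conjugate to multiplication by `N`. -/
theorem exists_conjugacy_circleMul {f : ℝ → ℝ} {N : ℕ} (hN : 2 ≤ N) (hc : Continuous f)
    (hper : ∀ x, f (x + 1) = f x + N) (hexp : ∀ x y, x < y → y - x < f y - f x)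
    {A : Circle → Circle} (hA : ∀ x, A (Circle.exp (2 * π * x)) = Circle.exp (2 * π * f x)) :
    ∃ Φ : UnitAddCircle ≃ₜ Circle, Function.Semiconj Φ (circleMul N) A := by
  obtain ⟨h, hhc, hmono, hhp, hhf⟩ := exists_linearization hN hc hper hexp
  have hsurj : Function.Surjective h := surjective_of_add_one hhc hhp
  -- The conjugacy goes from the linear model to the circle, so it descends from the inverse of `h`.
  set e := hmono.orderIsoOfSurjective h hsurj with he
  have hg1 : ∀ x, e.symm (x + 1) = e.symm x + 1 := fun x => by
    apply e.injective
    rw [e.apply_symm_apply]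
    change _ = h _
    rw [hhp]
    change _ = e (e.symm x) + 1
    rw [e.apply_symm_apply]
  have hgf : ∀ x, f (e.symm x) = e.symm (N * x) := fun x => by
    apply e.injective
    rw [e.apply_symm_apply]
    change h _ = _
    rw [hhf]
    change N * e (e.symm x) = _
    rw [e.apply_symm_apply]
  obtain ⟨Φ, hΦ⟩ := exists_homeomorph_of_lift e.symm.continuous e.symm.strictMono hg1
  refine ⟨Φ, fun a => ?_⟩
  obtain ⟨x, rfl⟩ := QuotientAddGroup.mk_surjective a
  rw [hΦ, hA, hgf, ← hΦ, circleMul, ← AddCircle.coe_nsmul, nsmul_eq_mul]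

end Conjugacy

/-! ### Blaschke factors in angular coordinates -/

section BlaschkeLift

/-- A lift to the line of the action of the Blaschke factor `z ↦ (z - a) / (1 - a z)` on the unit
circle. -/
noncomputable def blaschkeLift (a s : ℝ) : ℝ :=
  s + 2 * arctan (a * sin s / (1 - a * cos s))

variable {a : ℝ}

theorem one_sub_mul_cos_pos (ha : |a| < 1) (s : ℝ) : 0 < 1 - a * cos s := by
  have h1 : |a * cos s| < 1 := by
    rw [abs_mul]
    exact (mul_le_of_le_one_right (abs_nonneg a) (abs_cos_le_one s)).trans_lt ha
  linarith [le_abs_self (a * cos s)]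

/-- The derivative is the Poisson kernel; its explicit form gives monotonicity and, on a suitable
interval, expansion. -/
theorem hasDerivAt_blaschkeLift (ha : |a| < 1) (s : ℝ) :
    HasDerivAt (blaschkeLift a) ((1 - a ^ 2) / (1 - 2 * a * cos s + a ^ 2)) s := by
  have hD := one_sub_mul_cos_pos ha s
  have h1 := (((hasDerivAt_sin s).const_mul a).div
    (((hasDerivAt_cos s).const_mul a).const_sub 1) hD.ne').arctan
  have h2 := (hasDerivAt_id s).add (h1.const_mul 2)
  refine h2.congr_deriv ?_
  change 1 + 2 * (1 / (1 + (a * sin s / (1 - a * cos s)) ^ 2) *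
    ((a * cos s * (1 - a * cos s) - a * sin s * -(a * -sin s)) / (1 - a * cos s) ^ 2)) = _
  have hsq := sin_sq_add_cos_sq s
  have hE : 1 - 2 * a * cos s + a ^ 2 = (1 - a * cos s) ^ 2 + (a * sin s) ^ 2 := by
    linear_combination (-a ^ 2) * hsq
  have hE0 : (1 - a * cos s) ^ 2 + (a * sin s) ^ 2 ≠ 0 := by positivity
  have hF : 1 + (a * sin s / (1 - a * cos s)) ^ 2 =
      ((1 - a * cos s) ^ 2 + (a * sin s) ^ 2) / (1 - a * cos s) ^ 2 := by
    field_simp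
  rw [hE, hF, one_div_div, mul_comm (_ / _) (_ / (1 - a * cos s) ^ 2),
    div_mul_div_cancel₀ (by positivity), eq_div_iff hE0, add_mul, mul_assoc,
    div_mul_cancel₀ _ hE0]
  linear_combination (-a ^ 2) * hsq

theorem continuous_blaschkeLift (ha : |a| < 1) : Continuous (blaschkeLift a) :=
  continuous_iff_continuousAt.2 fun s => (hasDerivAt_blaschkeLift ha s).continuousAt

theorem strictMono_blaschkeLift (ha : |a| < 1) : StrictMono (blaschkeLift a) := by
  refine strictMono_of_deriv_pos fun s => ?_
  rw [(hasDerivAt_blaschkeLift ha s).deriv]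
  have h1 : a ^ 2 < 1 := by rwa [sq_lt_one_iff_abs_lt_one]
  have hD := one_sub_mul_cos_pos ha s
  refine div_pos (by linarith) ?_
  nlinarith [sin_sq_add_cos_sq s, sq_nonneg (a * sin s), sq_nonneg a, pow_pos hD 2]

theorem blaschkeLift_add_two_pi (s : ℝ) : blaschkeLift a (s + 2 * π) = blaschkeLift a s + 2 * π := by
  rw [blaschkeLift, blaschkeLift, sin_add_two_pi, cos_add_two_pi]
  ring

theorem blaschkeLift_neg (s : ℝ) : blaschkeLift a (-s) = -blaschkeLift a s := by
  rw [blaschkeLift, blaschkeLift, sin_neg, cos_neg, mul_neg, neg_div, arctan_neg]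
  ring

/-- For `a = cos α` the argument of `arctan` at `α` is `cot α = tan (π / 2 - α)`. -/
theorem blaschkeLift_cos_self {α : ℝ} (h0 : 0 < α) (h1 : α < π / 2) :
    blaschkeLift (cos α) α = π - α := by
  have hs : 0 < sin α := sin_pos_of_pos_of_lt_pi h0 (by linarith [pi_pos])
  have hc : 0 < cos α := cos_pos_of_mem_Ioo ⟨by linarith, h1⟩
  have h2 : cos α * sin α / (1 - cos α * cos α) = tan (π / 2 - α) := by
    rw [tan_eq_sin_div_cos, sin_pi_div_two_sub, cos_pi_div_two_sub]
    have : 1 - cos α * cos α = sin α * sin α := by linear_combination -sin_sq_add_cos_sq α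
    rw [this]
    field_simp
  rw [blaschkeLift, h2, arctan_tan (by linarith) (by linarith)]
  ring

/-- For `a = cos α` the Poisson kernel exceeds 1 exactly when `cos s > cos α`, that is, inside the
arc. It equals 1 at `±α`, the neutral vertices, which does not spoil strict monotonicity on the
closed interval. -/
theorem sub_lt_blaschkeLift_sub {α : ℝ} (h0 : 0 < α) (h1 : α < π / 2) {x y : ℝ}
    (hx : -α ≤ x) (hxy : x < y) (hy : y ≤ α) :
    y - x < blaschkeLift (cos α) y - blaschkeLift (cos α) x := by
  have hc : 0 < cos α := cos_pos_of_mem_Ioo ⟨by linarith, h1⟩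
  have hs : 0 < sin α := sin_pos_of_pos_of_lt_pi h0 (by linarith [pi_pos])
  have hc1 : |cos α| < 1 := by
    rw [abs_of_pos hc]
    nlinarith [sin_sq_add_cos_sq α]
  have hd := fun s => (hasDerivAt_blaschkeLift hc1 s).sub (hasDerivAt_id s)
  have hmono : StrictMonoOn (fun s => blaschkeLift (cos α) s - s) (Set.Icc (-α) α) := by
    refine strictMonoOn_of_deriv_pos (convex_Icc _ _)
      ((continuous_blaschkeLift hc1).sub continuous_id).continuousOn fun s hs' => ?_
    rw [interior_Icc] at hs'
    have he : deriv (fun s => blaschkeLift (cos α) s - s) s =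
      (1 - cos α ^ 2) / (1 - 2 * cos α * cos s + cos α ^ 2) - 1 := (hd s).deriv
    rw [he, sub_pos]
    have hcs : cos α < cos s := by
      rw [← cos_abs s]
      exact cos_lt_cos_of_nonneg_of_le_pi (abs_nonneg s) (by linarith)
        (abs_lt.2 ⟨hs'.1, hs'.2⟩)
    have hpos : 0 < 1 - 2 * cos α * cos s + cos α ^ 2 := by
      have hD := one_sub_mul_cos_pos hc1 s
      nlinarith [sin_sq_add_cos_sq s, sq_nonneg (cos α * sin s), pow_pos hD 2]
    rw [one_lt_div hpos]
    nlinarith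
  have := hmono ⟨hx, hxy.le.trans hy⟩ ⟨hx.trans hxy.le, hy⟩ hxy
  simp only at this
  linarith

/-- With `t` the argument of `arctan` and `w = exp (i s)`, one has `1 - a w = (1 - a cos s) (1 - i
t)`, and `2 arctan t` is the angle of `(1 + i t) / (1 - i t)`. -/
theorem exp_blaschkeLift (ha : |a| < 1) (s : ℝ) :
    (Circle.exp (blaschkeLift a s) : ℂ) * (1 - a * Circle.exp s) = Circle.exp s - a := by
  have hD := one_sub_mul_cos_pos ha s
  set t := a * sin s / (1 - a * cos s) with ht
  have hat : (Circle.exp (2 * arctan t) : ℂ) * (1 - t * Complex.I) = 1 + t * Complex.I := by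
    have h1 : (Circle.exp (arctan t) : ℂ) = (1 + t * Complex.I) / (√(1 + t ^ 2) : ℝ) := by
      rw [Circle.coe_exp, Complex.exp_mul_I, ← Complex.ofReal_cos, ← Complex.ofReal_sin,
        cos_arctan, sin_arctan]
      push_cast
      ring
    have h2 : ((√(1 + t ^ 2) : ℝ) : ℂ) ^ 2 = 1 + t ^ 2 := by
      rw [← Complex.ofReal_pow, sq_sqrt (by positivity)]
      push_cast
      ring
    have h3 : ((√(1 + t ^ 2) : ℝ) : ℂ) ≠ 0 := by
      rw [Complex.ofReal_ne_zero]
      positivity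
    rw [two_mul, Circle.exp_add, Circle.coe_mul, h1]
    field_simp
    rw [h2]
    linear_combination (-(1 + t * Complex.I) * t ^ 2) * Complex.I_sq
  have hw : (Circle.exp s : ℂ) = cos s + sin s * Complex.I := by
    rw [Circle.coe_exp, Complex.exp_mul_I, ← Complex.ofReal_cos, ← Complex.ofReal_sin]
  have hsq : (sin s : ℂ) ^ 2 + (cos s : ℂ) ^ 2 = 1 := by exact_mod_cast sin_sq_add_cos_sq s
  have hDc : (1 - a * cos s : ℂ) ≠ 0 := by exact_mod_cast hD.ne'
  have htc : (t : ℂ) * (1 - a * cos s) = a * sin s := by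
    have : t * (1 - a * cos s) = a * sin s := div_mul_cancel₀ _ hD.ne'
    exact_mod_cast this
  have hE : (1 - a * Circle.exp s : ℂ) = (1 - a * cos s) * (1 - t * Complex.I) := by
    rw [hw]
    linear_combination Complex.I * htc
  have hE' : (1 - a * cos s + a * sin s * Complex.I : ℂ) = (1 - a * cos s) * (1 + t * Complex.I) := by
    linear_combination -Complex.I * htc
  have hsplit : (Circle.exp (blaschkeLift a s) : ℂ) = Circle.exp s * Circle.exp (2 * arctan t) := by
    rw [blaschkeLift, Circle.exp_add, Circle.coe_mul]
  rw [hsplit, hE]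
  calc (Circle.exp s * Circle.exp (2 * arctan t) : ℂ) * ((1 - a * cos s) * (1 - t * Complex.I))
      = Circle.exp s * ((1 - a * cos s) *
          (Circle.exp (2 * arctan t) * (1 - t * Complex.I))) := by ring
    _ = Circle.exp s * (1 - a * cos s + a * sin s * Complex.I) := by rw [hat, hE']
    _ = Circle.exp s - a := by
      rw [hw]
      linear_combination (-(a : ℂ)) * hsq + (a * (sin s : ℂ) ^ 2) * Complex.I_sq

end BlaschkeLift

/-! ### Side pairings as rotated Blaschke factors -/

section SideMaps

variable {d : ℕ}

/-- Half the angle subtended by a side of the preferred domain. -/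
noncomputable def sideHalfAngle (d : ℕ) : ℝ := π / (2 * d)

/-- The argument of the midpoint of the arc subtended by side `k` of the preferred domain. -/
noncomputable def sideMid (d : ℕ) (k : ℕ) : ℝ := π * (2 * k + 1) / (2 * d)

/-- The lift to the line of the side pairings, up to rotations. -/
noncomputable def sideLift (d : ℕ) : ℝ → ℝ := blaschkeLift (cos (sideHalfAngle d))

theorem sideHalfAngle_pos (hd : 2 ≤ d) : 0 < sideHalfAngle d := (sideAngle_mem hd).1

theorem sideHalfAngle_lt (hd : 2 ≤ d) : sideHalfAngle d < π / 2 := (sideAngle_mem hd).2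

theorem cos_sideHalfAngle_pos (hd : 2 ≤ d) : 0 < cos (sideHalfAngle d) :=
  cos_pos_of_mem_Ioo ⟨by linarith [sideHalfAngle_pos hd, pi_pos], sideHalfAngle_lt hd⟩

theorem cos_sideHalfAngle_lt_one (hd : 2 ≤ d) : cos (sideHalfAngle d) < 1 := by
  have hs : 0 < sin (sideHalfAngle d) := sin_pos_of_pos_of_lt_pi (sideHalfAngle_pos hd)
    (by linarith [pi_pos, sideHalfAngle_lt hd])
  nlinarith [sin_sq_add_cos_sq (sideHalfAngle d), cos_sideHalfAngle_pos hd]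

theorem abs_cos_sideHalfAngle (hd : 2 ≤ d) : |cos (sideHalfAngle d)| < 1 := by
  rw [abs_of_pos (cos_sideHalfAngle_pos hd)]
  exact cos_sideHalfAngle_lt_one hd

/-- Rotating the midpoint of the arc to 1 puts the centre at `1 / a` with squared radius `(1 - a ^
2) / a ^ 2`. On the unit circle that inversion sends `w` to minus the conjugate of `(w - a) / (1 - a
w)`. -/
theorem hypReflection_exp (hd : 2 ≤ d) (j : Fin d) (s : ℝ) :
    hypReflection (sideCenter d j) (sideRadius d) (sideRadius_ne_zero hd)
      (norm_sideCenter_sq hd j) (Circle.exp (sideMid d j + s)) =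
        Circle.exp (sideMid d j - π - sideLift d s) := by
  set a := cos (sideHalfAngle d) with ha
  have ha0 : 0 < a := cos_sideHalfAngle_pos hd
  have ha1 : |a| < 1 := abs_cos_sideHalfAngle hd
  have hac : (a : ℂ) ≠ 0 := by exact_mod_cast ha0.ne'
  set e : Circle := Circle.exp (sideMid d j) with he
  set w : Circle := Circle.exp s with hw
  have hr : sideRadius d ^ 2 = (1 - a ^ 2) / a ^ 2 := by
    rw [sideRadius, tan_eq_sin_div_cos, div_pow]
    change sin (sideHalfAngle d) ^ 2 / a ^ 2 = _
    rw [sin_sq]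
  have hc : sideCenter d j = (a : ℂ)⁻¹ * e := by
    rw [sideCenter, Complex.ofReal_inv]
    rfl
  have hz : ((Circle.exp (sideMid d j + s) : Circle) : ℂ) = e * w := by
    rw [Circle.exp_add, Circle.coe_mul]
  have hww : (w : ℂ) * (starRingEnd ℂ w) = 1 := by
    rw [Complex.mul_conj, Circle.normSq_coe, Complex.ofReal_one]
  have hee : (e : ℂ) * (starRingEnd ℂ e) = 1 := by
    rw [Complex.mul_conj, Circle.normSq_coe, Complex.ofReal_one]
  have hB : starRingEnd ℂ (Circle.exp (blaschkeLift a s)) * (1 - a * starRingEnd ℂ w) =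
      starRingEnd ℂ w - a := by
    have := congrArg (starRingEnd ℂ) (exp_blaschkeLift ha1 s)
    simp only [map_mul, map_sub, map_one, Complex.conj_ofReal] at this
    exact this
  have hne : (1 - a * (starRingEnd ℂ w) : ℂ) ≠ 0 := by
    intro h
    have h1 : ‖(a : ℂ) * (starRingEnd ℂ w)‖ = 1 := by
      rw [← sub_eq_zero.1 h, norm_one]
    rw [norm_mul, Complex.norm_conj, Circle.norm_coe, mul_one, Complex.norm_real,
      Real.norm_eq_abs] at h1
    linarith
  apply Circle.ext
  change EuclideanGeometry.inversion (sideCenter d j) (sideRadius d)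
    (Circle.exp (sideMid d j + s) : ℂ) = _
  have hrhs : ((Circle.exp (sideMid d j - π - sideLift d s) : Circle) : ℂ) =
      -(e * starRingEnd ℂ (Circle.exp (blaschkeLift a s))) := by
    rw [Circle.exp_sub, Circle.exp_sub, Circle.coe_div, Circle.coe_div]
    rw [div_eq_mul_inv _ ((Circle.exp (sideLift d s) : Circle) : ℂ), ← Circle.coe_inv,
      Circle.coe_inv_eq_conj]
    have : ((Circle.exp π : Circle) : ℂ) = -1 := by simp [Circle.coe_exp]
    rw [this]
    change (e : ℂ) / -1 * starRingEnd ℂ (Circle.exp (blaschkeLift a s)) = _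
    ring
  rw [hrhs]
  have hdist : ((dist ((Circle.exp (sideMid d j + s) : Circle) : ℂ) (sideCenter d j) ^ 2 : ℝ) : ℂ) =
      (w - (a : ℂ)⁻¹) * (starRingEnd ℂ w - (a : ℂ)⁻¹) := by
    rw [dist_eq_norm, ← Complex.normSq_eq_norm_sq, ← Complex.mul_conj, hz, hc]
    simp only [map_sub, map_mul, map_inv₀, Complex.conj_ofReal]
    linear_combination (w - (a : ℂ)⁻¹) * (starRingEnd ℂ w - (a : ℂ)⁻¹) * hee
  have hwa : (w - (a : ℂ)⁻¹ : ℂ) ≠ 0 := by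
    intro h
    apply hne
    have h2 := congrArg (starRingEnd ℂ) (sub_eq_zero.1 h)
    rw [map_inv₀, Complex.conj_ofReal] at h2
    rw [h2, mul_inv_cancel₀ hac, sub_self]
  have hwa' : (starRingEnd ℂ w - (a : ℂ)⁻¹ : ℂ) ≠ 0 := by
    intro h
    apply hne
    rw [sub_eq_zero.1 h, mul_inv_cancel₀ hac, sub_self]
  have hinv : EuclideanGeometry.inversion (sideCenter d j) (sideRadius d)
      (Circle.exp (sideMid d j + s) : ℂ) =
      ((sideRadius d ^ 2 : ℝ) : ℂ) /
        ((dist ((Circle.exp (sideMid d j + s) : Circle) : ℂ) (sideCenter d j) ^ 2 : ℝ) : ℂ) *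
        ((Circle.exp (sideMid d j + s) : Circle) - sideCenter d j) + sideCenter d j := by
    simp [EuclideanGeometry.inversion, div_pow]
  rw [hinv, hdist, hr, hz, hc, eq_div_of_mul_eq hne hB,
    Complex.ofReal_div, Complex.ofReal_sub, Complex.ofReal_pow, Complex.ofReal_one]
  have hne' : (a * starRingEnd ℂ w - 1 : ℂ) ≠ 0 := by
    rw [← neg_sub]
    exact neg_ne_zero.2 hne
  have e1 : (w - (a : ℂ)⁻¹ : ℂ) = (a * w - 1) / a := by field_simp
  have hwa1 : (a * w - 1 : ℂ) ≠ 0 := fun h => hwa (by rw [e1, h, zero_div])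
  have e2 : (starRingEnd ℂ w - (a : ℂ)⁻¹ : ℂ) = (a * starRingEnd ℂ w - 1) / a := by field_simp
  have e3 : (e * w - (a : ℂ)⁻¹ * e : ℂ) = e * ((a * w - 1) / a) := by field_simp
  have e4 : (1 - a * starRingEnd ℂ w : ℂ) = -(a * starRingEnd ℂ w - 1) := by ring
  rw [e1, e2, e3, e4]
  field_simp
  ring

theorem sideGenerator_exp (hd : 2 ≤ d) (j : Fin d) (s : ℝ) :
    sideGenerator hd j (Circle.exp (sideMid d j + s)) =
      Circle.exp (π - sideMid d j + sideLift d s) := by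
  change (hypReflection _ _ _ _ _)⁻¹ = _
  rw [hypReflection_exp hd, ← Circle.exp_neg]
  congr 1
  ring

/-- Reflection and conjugation are involutions, so the inverse sends `z` to the reflection of `z⁻¹`;
oddness of the lift restores the shape found for the generator. -/
theorem sideGenerator_inv_exp (hd : 2 ≤ d) (j : Fin d) (s : ℝ) :
    (sideGenerator hd j)⁻¹ (Circle.exp (-sideMid d j + s)) =
      Circle.exp (π + sideMid d j + sideLift d s) := by
  change hypReflection (sideCenter d j) (sideRadius d) (sideRadius_ne_zero hd)
      (norm_sideCenter_sq hd j) (Circle.exp (-sideMid d j + s))⁻¹ = _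
  rw [← Circle.exp_neg, neg_add, neg_neg, hypReflection_exp hd, sideLift, blaschkeLift_neg,
    Circle.exp_eq_exp]
  exact ⟨-1, by push_cast; ring⟩

end SideMaps

/-! ### The Bowen-Series map and its expanding lift -/

section BowenSeries

/-- The half-open arc of the circle subtended by side `i` of an ideal polygon. -/
def MarkedIdealPolygon.arc {n : ℕ} (R : MarkedIdealPolygon n) (i : Fin n) : Set Circle :=
  ccwArc (R.vertex i) (R.vertex (finRotate n i))

theorem MarkedIdealPolygon.bowenSeriesMap_eq {n : ℕ} {R : MarkedIdealPolygon n}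
    (hR : ∀ z i j, z ∈ R.arc i → z ∈ R.arc j → i = j) {i : Fin n} {z : Circle} (hz : z ∈ R.arc i) :
    R.bowenSeriesMap z = R.pairing i z := by
  have h : ∃ i, z ∈ ccwArc (R.vertex i) (R.vertex (finRotate n i)) := ⟨i, hz⟩
  rw [MarkedIdealPolygon.bowenSeriesMap, dif_pos h, hR z _ _ h.choose_spec hz]

/-- If `γ` preserves counter-clockwise arcs, the Bowen-Series map of the translate by `γ` is the
conjugate by `γ` of the Bowen-Series map. -/
theorem MarkedIdealPolygon.bowenSeriesMap_translate {n : ℕ} {R : MarkedIdealPolygon n}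
    (hR : ∀ z i j, z ∈ R.arc i → z ∈ R.arc j → i = j) (hcov : ∀ z, ∃ i, z ∈ R.arc i)
    {γ : Circle ≃ₜ Circle} (hγ : ∀ a b z, γ z ∈ ccwArc (γ a) (γ b) ↔ z ∈ ccwArc a b) (z : Circle) :
    (R.translate γ).bowenSeriesMap (γ z) = γ (R.bowenSeriesMap z) := by
  have harc : ∀ w i, γ w ∈ (R.translate γ).arc i ↔ w ∈ R.arc i := fun w i => hγ _ _ _
  have hR' : ∀ w i j, w ∈ (R.translate γ).arc i → w ∈ (R.translate γ).arc j → i = j := by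
    intro w i j hi hj
    obtain ⟨w, rfl⟩ := γ.surjective w
    exact hR w i j ((harc w i).1 hi) ((harc w j).1 hj)
  obtain ⟨i, hi⟩ := hcov z
  rw [MarkedIdealPolygon.bowenSeriesMap_eq hR hi,
    MarkedIdealPolygon.bowenSeriesMap_eq hR' ((harc z i).2 hi)]
  change γ (R.pairing i (γ.symm (γ z))) = _
  rw [γ.symm_apply_apply]

variable {d : ℕ}

theorem sideMid_eq (d k : ℕ) : sideMid d k = sideHalfAngle d * (2 * k + 1) := by
  rw [sideMid, sideHalfAngle]
  ring

theorem sideHalfAngle_mul (hd : 2 ≤ d) : sideHalfAngle d * (2 * d) = π := by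
  rw [sideHalfAngle]
  field_simp

theorem vertex_preferredDomain (hd : 2 ≤ d) (k : Fin (2 * d)) :
    (preferredDomain hd).vertex k = Circle.exp (sideMid d k - sideHalfAngle d) := by
  change Circle.exp (π * (k : ℕ) / d) = _
  congr 1
  rw [sideMid_eq, ← sideHalfAngle_mul hd]
  field_simp
  ring

theorem vertex_finRotate (hd : 2 ≤ d) (k : Fin (2 * d)) :
    (preferredDomain hd).vertex (finRotate _ k) =
      Circle.exp (2 * sideHalfAngle d) * (preferredDomain hd).vertex k := by
  have hval : ((finRotate _ k : Fin (2 * d)) : ℕ) =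
      (if (k : ℕ) + 1 = 2 * d then 0 else (k : ℕ) + 1 : ℕ) := by
    have := k.neZero
    rw [finRotate_apply, Fin.val_add]
    have h1 : ((1 : Fin (2 * d)) : ℕ) = 1 :=
      (show ((1 : Fin (2 * d)) : ℕ) = 1 % (2 * d) from rfl).trans (Nat.mod_eq_of_lt (by omega))
    rw [h1]
    split_ifs with h
    · rw [h, Nat.mod_self]
    · exact Nat.mod_eq_of_lt (by omega)
  rw [vertex_preferredDomain, vertex_preferredDomain, ← Circle.exp_add, Circle.exp_eq_exp,
    sideMid_eq, sideMid_eq, hval]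
  have hα := sideHalfAngle_mul hd
  split_ifs with h
  · have hk : ((k : ℕ) : ℝ) = 2 * d - 1 := by
      rw [eq_sub_iff_add_eq]
      exact_mod_cast h
    refine ⟨-1, ?_⟩
    rw [hk]
    push_cast
    linear_combination -2 * hα
  · refine ⟨0, ?_⟩
    push_cast
    ring

theorem mem_arc_preferredDomain (hd : 2 ≤ d) (k : Fin (2 * d)) (z : Circle) :
    z ∈ (preferredDomain hd).arc k ↔
      ∃ s ∈ Set.Ico (-sideHalfAngle d) (sideHalfAngle d), z = Circle.exp (sideMid d k + s) := by
  have h0 := sideHalfAngle_pos hd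
  have h1 := sideHalfAngle_lt hd
  rw [MarkedIdealPolygon.arc, vertex_finRotate, vertex_preferredDomain]
  constructor
  · rintro ⟨s, t, hs, hst, ht, hb, rfl⟩
    have hexp := mul_right_cancel hb
    obtain ⟨m, hm⟩ := Circle.exp_eq_exp.1 hexp
    -- The angle to the next vertex is known only modulo `2 π`, but both `t` and `2 α` lie in `(0, 2
    -- π)`.
    have hm0 : m = 0 := by
      have hπ := pi_pos
      have h2 : (m : ℝ) < 1 := by nlinarith
      have h3 : (-1 : ℝ) < m := by nlinarith
      have h2' : m < 1 := by exact_mod_cast h2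
      have h3' : -1 < m := by exact_mod_cast h3
      omega
    rw [hm0, Int.cast_zero, zero_mul, add_zero] at hm
    refine ⟨s - sideHalfAngle d, ⟨by linarith, by linarith⟩, ?_⟩
    rw [← Circle.exp_add]
    congr 1
    ring
  · rintro ⟨s, ⟨hs1, hs2⟩, rfl⟩
    refine ⟨s + sideHalfAngle d, 2 * sideHalfAngle d, by linarith, by linarith, by linarith, rfl, ?_⟩
    rw [← Circle.exp_add]
    congr 1
    ring

theorem exists_sideMid_add (hd : 2 ≤ d) (x : ℝ) :
    ∃ k : ℤ, ∃ s ∈ Set.Ico (-sideHalfAngle d) (sideHalfAngle d),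
      x = sideHalfAngle d * (2 * k + 1) + s := by
  have h0 := sideHalfAngle_pos hd
  have h2 : 0 < 2 * sideHalfAngle d := by linarith
  refine ⟨⌊x / (2 * sideHalfAngle d)⌋,
    x - sideHalfAngle d * (2 * ⌊x / (2 * sideHalfAngle d)⌋ + 1), ?_, by ring⟩
  have h3 := Int.floor_le (x / (2 * sideHalfAngle d))
  have h4 := Int.lt_floor_add_one (x / (2 * sideHalfAngle d))
  rw [le_div_iff₀ h2] at h3
  rw [div_lt_iff₀ h2] at h4
  constructor <;> linarith

theorem exp_sideMid_int (hd : 2 ≤ d) (k : ℤ) :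
    ∃ (k' : Fin (2 * d)) (m : ℤ), sideHalfAngle d * (2 * k + 1) = sideMid d k' + m * (2 * π) := by
  have h2d : (0 : ℤ) < 2 * d := by omega
  have h1 := Int.emod_nonneg k h2d.ne'
  have h2 := Int.emod_lt_of_pos k h2d
  refine ⟨⟨(k % (2 * d)).toNat, by omega⟩, k / (2 * d), ?_⟩
  have h3 : (((k % (2 * d)).toNat : ℕ) : ℝ) = ((k % (2 * d) : ℤ) : ℝ) := by
    exact_mod_cast Int.toNat_of_nonneg h1
  have h4 : (k : ℝ) = ((k % (2 * d) : ℤ) : ℝ) + 2 * d * ((k / (2 * d) : ℤ) : ℝ) := by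
    exact_mod_cast (Int.emod_add_mul_ediv k (2 * d)).symm
  rw [sideMid_eq, h3, ← sideHalfAngle_mul hd]
  linear_combination (2 * sideHalfAngle d) * h4

theorem arc_preferredDomain_cover (hd : 2 ≤ d) (z : Circle) :
    ∃ k, z ∈ (preferredDomain hd).arc k := by
  obtain ⟨x, rfl⟩ := Circle.exp_surjective z
  obtain ⟨k, s, hs, rfl⟩ := exists_sideMid_add hd x
  obtain ⟨k', m, hk⟩ := exp_sideMid_int hd k
  refine ⟨k', (mem_arc_preferredDomain hd k' _).2 ⟨s, hs, ?_⟩⟩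
  exact Circle.exp_eq_exp.2 ⟨m, by rw [hk]; ring⟩

theorem arc_preferredDomain_unique (hd : 2 ≤ d) (z : Circle) (i j : Fin (2 * d))
    (hi : z ∈ (preferredDomain hd).arc i) (hj : z ∈ (preferredDomain hd).arc j) : i = j := by
  have h0 := sideHalfAngle_pos hd
  obtain ⟨s, ⟨hs1, hs2⟩, rfl⟩ := (mem_arc_preferredDomain hd i _).1 hi
  obtain ⟨t, ⟨ht1, ht2⟩, ht⟩ := (mem_arc_preferredDomain hd j _).1 hj
  obtain ⟨m, hm⟩ := Circle.exp_eq_exp.1 ht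
  rw [sideMid_eq, sideMid_eq, ← sideHalfAngle_mul hd] at hm
  have key : ((i : ℤ) - j - 2 * d * m : ℤ) = 0 := by
    have h1 : sideHalfAngle d * (2 * (((i : ℤ) - j - 2 * d * m : ℤ) : ℝ)) = t - s := by
      push_cast
      linear_combination hm
    have h2 : (((i : ℤ) - j - 2 * d * m : ℤ) : ℝ) < 1 := by
      by_contra! h
      nlinarith
    have h3 : -1 < (((i : ℤ) - j - 2 * d * m : ℤ) : ℝ) := by
      by_contra! h
      nlinarith
    have h2' : ((i : ℤ) - j - 2 * d * m : ℤ) < 1 := by exact_mod_cast h2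
    have h3' : -1 < ((i : ℤ) - j - 2 * d * m : ℤ) := by exact_mod_cast h3
    omega
  have hi2 := i.2
  have hj2 := j.2
  have hdvd : ((2 * d : ℕ) : ℤ) ∣ (i : ℤ) - j := ⟨m, by push_cast; linarith⟩
  have habs : |(i : ℤ) - j| < ((2 * d : ℕ) : ℤ) := by
    rw [abs_lt]
    constructor <;> omega
  have := Int.eq_zero_of_abs_lt_dvd hdvd habs
  exact Fin.ext (by omega)

/-- Mirror sides have midpoints summing to `2 π`, so the formulas for the generators and for their
inverses become a single formula. -/
theorem pairing_exp (hd : 2 ≤ d) (k : Fin (2 * d)) (s : ℝ) :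
    (preferredDomain hd).pairing k (Circle.exp (sideMid d k + s)) =
      Circle.exp (π - sideMid d k + sideLift d s) := by
  by_cases h : (k : ℕ) < d
  · have : (preferredDomain hd).pairing k = sideGenerator hd ⟨k, h⟩ := dif_pos h
    rw [this]
    exact sideGenerator_exp hd ⟨k, h⟩ s
  · set j : Fin d := ⟨2 * d - 1 - k, by omega⟩ with hj
    have : (preferredDomain hd).pairing k = (sideGenerator hd j)⁻¹ := dif_neg h
    have hmid : sideMid d j = 2 * π - sideMid d k := by
      have hk : ((2 * d - 1 - (k : ℕ) : ℕ) : ℝ) = 2 * d - 1 - (k : ℕ) := by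
        have := k.2
        rw [Nat.cast_sub (by omega), Nat.cast_sub (by omega)]
        push_cast
        ring
      rw [sideMid_eq, sideMid_eq, hj, ← sideHalfAngle_mul hd]
      simp only [hk]
      ring
    have hz : Circle.exp (sideMid d k + s) = Circle.exp (-sideMid d j + s) :=
      Circle.exp_eq_exp.2 ⟨1, by rw [hmid]; push_cast; ring⟩
    rw [this, hz, sideGenerator_inv_exp]
    exact Circle.exp_eq_exp.2 ⟨1, by rw [hmid]; push_cast; ring⟩

theorem pairing_rev (hd : 2 ≤ d) (k : Fin (2 * d)) :
    (preferredDomain hd).pairing (Fin.rev k) = ((preferredDomain hd).pairing k)⁻¹ := by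
  have hk := k.2
  have hrev : ((Fin.rev k : Fin (2 * d)) : ℕ) = 2 * d - (k + 1) := Fin.val_rev k
  by_cases h : (k : ℕ) < d
  · have h1 : (preferredDomain hd).pairing k = sideGenerator hd ⟨k, h⟩ := dif_pos h
    have h2 : ¬ ((Fin.rev k : Fin (2 * d)) : ℕ) < d := by omega
    have h3 : (preferredDomain hd).pairing (Fin.rev k) =
        (sideGenerator hd ⟨2 * d - 1 - (Fin.rev k : Fin (2 * d)), by omega⟩)⁻¹ := dif_neg h2
    rw [h1, h3]
    congr 2
    exact Fin.ext (by simp only; omega)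
  · have h1 : (preferredDomain hd).pairing k = (sideGenerator hd ⟨2 * d - 1 - k, by omega⟩)⁻¹ :=
      dif_neg h
    have h2 : ((Fin.rev k : Fin (2 * d)) : ℕ) < d := by omega
    have h3 : (preferredDomain hd).pairing (Fin.rev k) =
        sideGenerator hd ⟨(Fin.rev k : Fin (2 * d)), h2⟩ := dif_pos h2
    rw [h1, h3, inv_inv]
    congr 1
    exact Fin.ext (by simp only; omega)

theorem sideLift_halfAngle (hd : 2 ≤ d) : sideLift d (sideHalfAngle d) = π - sideHalfAngle d :=
  blaschkeLift_cos_self (sideHalfAngle_pos hd) (sideHalfAngle_lt hd)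

theorem sideLift_neg_halfAngle (hd : 2 ≤ d) :
    sideLift d (-sideHalfAngle d) = -(π - sideHalfAngle d) := by
  rw [sideLift, blaschkeLift_neg]
  exact congrArg Neg.neg (sideLift_halfAngle hd)

theorem strictMono_sideLift (hd : 2 ≤ d) : StrictMono (sideLift d) :=
  strictMono_blaschkeLift (abs_cos_sideHalfAngle hd)

/-- Off the arc of side `k`, the Bowen-Series map undoes the pairing of side `k`. -/
theorem pairing_mem_arc_rev (hd : 2 ≤ d) (k : Fin (2 * d)) {z : Circle}
    (hz : z ∉ (preferredDomain hd).arc k) :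
    (preferredDomain hd).pairing k z ∈ (preferredDomain hd).arc (Fin.rev k) := by
  have h0 := sideHalfAngle_pos hd
  obtain ⟨s, hs, rfl⟩ : ∃ s ∈ Set.Ico (-sideHalfAngle d) (-sideHalfAngle d + 2 * π),
      z = Circle.exp (sideMid d k + s) := by
    obtain ⟨x, rfl⟩ := Circle.exp_surjective z
    obtain ⟨y, hy, hxy⟩ := Circle.periodic_exp.exists_mem_Ico two_pi_pos x
      (sideMid d k - sideHalfAngle d)
    refine ⟨y - sideMid d k, ⟨by linarith [hy.1], by linarith [hy.2]⟩, ?_⟩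
    rw [hxy]
    congr 1
    ring
  have hs1 : sideHalfAngle d ≤ s := by
    by_contra! h
    exact hz ((mem_arc_preferredDomain hd k _).2 ⟨s, ⟨hs.1, h⟩, rfl⟩)
  -- The lift takes `[α, 2 π - α)` into `[π - α, π + α)`; subtracting `π` gives the half-open
  -- offsets of the mirror arc, closed at the correct end.
  have hB1 := (strictMono_sideLift hd).monotone hs1
  have hB2 := (strictMono_sideLift hd) hs.2
  rw [sideLift_halfAngle hd] at hB1
  have hB3 : sideLift d (-sideHalfAngle d + 2 * π) = sideLift d (-sideHalfAngle d) + 2 * π :=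
    blaschkeLift_add_two_pi _
  rw [hB3, sideLift_neg_halfAngle hd] at hB2
  rw [pairing_exp, mem_arc_preferredDomain]
  refine ⟨sideLift d s - π, ⟨by linarith, by linarith⟩, Circle.exp_eq_exp.2 ⟨0, ?_⟩⟩
  have hrev : ((Fin.rev k : Fin (2 * d)) : ℕ) = 2 * d - (k + 1) := Fin.val_rev k
  have hcast : (((Fin.rev k : Fin (2 * d)) : ℕ) : ℝ) = 2 * d - ((k : ℕ) + 1) := by
    rw [hrev, Nat.cast_sub (by omega)]
    push_cast
    ring
  rw [sideMid_eq, sideMid_eq, hcast]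
  have := sideHalfAngle_mul hd
  push_cast
  linear_combination -2 * this

/-- On arc `k` the map is the pairing itself. Any other point is sent by the pairing into the mirror
arc, where the map applies the inverse pairing. -/
theorem bowenSeriesMap_dichotomy (hd : 2 ≤ d) (k : Fin (2 * d)) (z : Circle) :
    (preferredDomain hd).bowenSeriesMap z = (preferredDomain hd).pairing k z ∨
      (preferredDomain hd).bowenSeriesMap ((preferredDomain hd).pairing k z) = z := by
  by_cases hz : z ∈ (preferredDomain hd).arc k
  · exact Or.inl (MarkedIdealPolygon.bowenSeriesMap_eq (arc_preferredDomain_unique hd) hz)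
  · refine Or.inr ?_
    rw [MarkedIdealPolygon.bowenSeriesMap_eq (arc_preferredDomain_unique hd)
      (pairing_mem_arc_rev hd k hz), pairing_rev]
    exact ((preferredDomain hd).pairing k).symm_apply_apply z

/-- A lift of the Bowen-Series map of the preferred domain. -/
noncomputable def bowenSeriesLift (hd : 2 ≤ d) (x : ℝ) : ℝ :=
  haveI : Fact (0 < 2 * sideHalfAngle d) := ⟨by linarith [sideHalfAngle_pos hd]⟩
  -- A linear part of the right degree plus a correction of period `2 α`. Midpoints are odd
  -- multiples of `α`, so after subtracting `α` the correction sees only the offset from the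
  -- midpoint.
  (2 * d - 1 : ℕ) * x + AddCircle.liftIco (2 * sideHalfAngle d) (-sideHalfAngle d)
    (fun s => sideLift d s - (2 * d - 1 : ℕ) * s)
      ((x - sideHalfAngle d : ℝ) : AddCircle (2 * sideHalfAngle d))

theorem cast_two_mul_sub_one (hd : 2 ≤ d) : ((2 * d - 1 : ℕ) : ℝ) = 2 * d - 1 := by
  rw [Nat.cast_sub (by omega)]
  push_cast
  ring

theorem continuous_bowenSeriesLift (hd : 2 ≤ d) : Continuous (bowenSeriesLift hd) := by
  have : Fact (0 < 2 * sideHalfAngle d) := ⟨by linarith [sideHalfAngle_pos hd]⟩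
  have hl : Continuous (AddCircle.liftIco (2 * sideHalfAngle d) (-sideHalfAngle d)
      (fun s => sideLift d s - (2 * d - 1 : ℕ) * s)) := by
    refine AddCircle.liftIco_continuous ?_ ?_
    -- The correction vanishes at both ends of the interval, since `(π - α) - (2 d - 1) α = π - 2 d
    -- α = 0`.
    · have : -sideHalfAngle d + 2 * sideHalfAngle d = sideHalfAngle d := by ring
      rw [this, sideLift_halfAngle hd, sideLift_neg_halfAngle hd, cast_two_mul_sub_one hd]
      linear_combination 2 * sideHalfAngle_mul hd
    · exact ((continuous_blaschkeLift (abs_cos_sideHalfAngle hd)).sub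
        (continuous_const.mul continuous_id)).continuousOn
  exact (continuous_const.mul continuous_id).add
    (hl.comp ((AddCircle.continuous_mk' _).comp (continuous_id.sub continuous_const)))

theorem bowenSeriesLift_add_two_pi (hd : 2 ≤ d) (x : ℝ) :
    bowenSeriesLift hd (x + 2 * π) = bowenSeriesLift hd x + (2 * d - 1 : ℕ) * (2 * π) := by
  unfold bowenSeriesLift
  have : ((x + 2 * π - sideHalfAngle d : ℝ) : AddCircle (2 * sideHalfAngle d)) =
      ((x - sideHalfAngle d : ℝ) : AddCircle (2 * sideHalfAngle d)) := by
    rw [← sub_eq_zero, ← AddCircle.coe_sub, AddCircle.coe_eq_zero_iff]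
    refine ⟨2 * d, ?_⟩
    rw [zsmul_eq_mul]
    push_cast
    linear_combination 2 * sideHalfAngle_mul hd
  rw [this]
  ring

theorem bowenSeriesLift_sideMid (hd : 2 ≤ d) (k : ℤ) {s : ℝ}
    (hs : s ∈ Set.Ico (-sideHalfAngle d) (sideHalfAngle d)) :
    bowenSeriesLift hd (sideHalfAngle d * (2 * k + 1) + s) =
      (2 * d - 1 : ℕ) * (sideHalfAngle d * (2 * k + 1)) + sideLift d s := by
  have : Fact (0 < 2 * sideHalfAngle d) := ⟨by linarith [sideHalfAngle_pos hd]⟩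
  unfold bowenSeriesLift
  have : ((sideHalfAngle d * (2 * k + 1) + s - sideHalfAngle d : ℝ) :
      AddCircle (2 * sideHalfAngle d)) = (s : AddCircle (2 * sideHalfAngle d)) := by
    rw [← sub_eq_zero, ← AddCircle.coe_sub, AddCircle.coe_eq_zero_iff]
    refine ⟨k, ?_⟩
    rw [zsmul_eq_mul]
    ring
  rw [this, AddCircle.liftIco_coe_apply ⟨hs.1, by linarith [hs.2]⟩]
  ring

theorem sub_lt_bowenSeriesLift_sub (hd : 2 ≤ d) {x y : ℝ} (hxy : x < y) :
    y - x < bowenSeriesLift hd y - bowenSeriesLift hd x := by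
  have h0 := sideHalfAngle_pos hd
  have h1 := sideHalfAngle_lt hd
  obtain ⟨k, s, hs, rfl⟩ := exists_sideMid_add hd x
  obtain ⟨l, t, ht, rfl⟩ := exists_sideMid_add hd y
  rw [bowenSeriesLift_sideMid hd k hs, bowenSeriesLift_sideMid hd l ht]
  have hkl : k ≤ l := by
    by_contra! h
    have : (l : ℝ) + 1 ≤ k := by exact_mod_cast h
    nlinarith [hs.1, ht.2]
  rcases hkl.eq_or_lt with rfl | hlt
  · have hst : s < t := by linarith
    have := sub_lt_blaschkeLift_sub h0 h1 hs.1 hst ht.2.le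
    change t - s < sideLift d t - sideLift d s at this
    linarith
  -- Points on different arcs: the rest of the first arc expands strictly, the initial piece of the
  -- last one weakly, and the `l - k - 1` full arcs between them are stretched by `2 d - 1`, which
  -- leaves the surplus `h3`.
  · have hlt' : (k : ℝ) + 1 ≤ l := by exact_mod_cast hlt
    have e1 := sub_lt_blaschkeLift_sub h0 h1 hs.1 hs.2 le_rfl
    change sideHalfAngle d - s < sideLift d (sideHalfAngle d) - sideLift d s at e1
    have e2 : t - -sideHalfAngle d ≤ sideLift d t - sideLift d (-sideHalfAngle d) := by
      rcases ht.1.eq_or_lt with h | h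
      · rw [← h, sub_self, sub_self]
      · exact (sub_lt_blaschkeLift_sub h0 h1 le_rfl h ht.2.le).le
    rw [sideLift_halfAngle hd] at e1
    rw [sideLift_neg_halfAngle hd] at e2
    rw [cast_two_mul_sub_one hd]
    have hα := sideHalfAngle_mul hd
    have hd' : (2 : ℝ) ≤ d := by exact_mod_cast hd
    have h3 : 0 ≤ (2 * d - 2) * (2 * sideHalfAngle d) * ((l : ℝ) - k - 1) :=
      mul_nonneg (mul_nonneg (by linarith) (by linarith)) (by linarith)
    nlinarith

/-- `2 d` times a midpoint is an odd multiple of `π`. Modulo `2 π`, the constant `π - sideMid d k`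
of the pairing is therefore `(2 d - 1) * sideMid d k`. -/
theorem bowenSeriesMap_exp (hd : 2 ≤ d) (x : ℝ) :
    (preferredDomain hd).bowenSeriesMap (Circle.exp x) = Circle.exp (bowenSeriesLift hd x) := by
  obtain ⟨k, s, hs, rfl⟩ := exists_sideMid_add hd x
  obtain ⟨k', m, hk⟩ := exp_sideMid_int hd k
  have hz : Circle.exp (sideHalfAngle d * (2 * k + 1) + s) = Circle.exp (sideMid d k' + s) :=
    Circle.exp_eq_exp.2 ⟨m, by rw [hk]; ring⟩
  rw [bowenSeriesLift_sideMid hd k hs, hz,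
    MarkedIdealPolygon.bowenSeriesMap_eq (arc_preferredDomain_unique hd)
      ((mem_arc_preferredDomain hd k' _).2 ⟨s, hs, rfl⟩), pairing_exp]
  refine Circle.exp_eq_exp.2 ⟨m - k, ?_⟩
  rw [cast_two_mul_sub_one hd]
  push_cast
  linear_combination (-2 * (k : ℝ) - 1) * sideHalfAngle_mul hd + hk

/-- The Bowen-Series map of the preferred domain is conjugate to multiplication by `2d - 1`. -/
theorem exists_conjugacy_bowenSeriesMap (hd : 2 ≤ d) :
    ∃ Φ : UnitAddCircle ≃ₜ Circle,
      Function.Semiconj Φ (circleMul (2 * d - 1)) (preferredDomain hd).bowenSeriesMap := by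
  have hπ := two_pi_pos
  refine exists_conjugacy_circleMul (f := fun x => bowenSeriesLift hd (2 * π * x) / (2 * π))
    (by omega) ?_ (fun x => ?_) (fun x y hxy => ?_) (fun x => ?_)
  · exact ((continuous_bowenSeriesLift hd).comp (continuous_const.mul continuous_id)).div_const _
  · rw [mul_add, mul_one, bowenSeriesLift_add_two_pi, add_div, mul_div_cancel_right₀ _ hπ.ne']
  · have := sub_lt_bowenSeriesLift_sub hd (mul_lt_mul_of_pos_left hxy hπ)
    rw [← sub_div, lt_div_iff₀ hπ]
    linarith
  · rw [bowenSeriesMap_exp, mul_div_cancel₀ _ hπ.ne']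

end BowenSeries

/-! ### Action of the group on arcs, dimension and measure classes -/

section GroupAction

theorem mem_ccwArc_of_lift {γ : Circle → Circle} {G : ℝ → ℝ} (hG : StrictMono G)
    (hper : ∀ x, G (x + 2 * π) = G x + 2 * π) (hγ : ∀ x, γ (Circle.exp x) = Circle.exp (G x))
    {a b z : Circle} (hz : z ∈ ccwArc a b) : γ z ∈ ccwArc (γ a) (γ b) := by
  obtain ⟨s, t, hs, hst, ht, rfl, rfl⟩ := hz
  obtain ⟨u, rfl⟩ := Circle.exp_surjective a
  refine ⟨G (s + u) - G u, G (t + u) - G u, ?_, ?_, ?_, ?_, ?_⟩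
  · exact sub_nonneg.2 (hG.monotone (by linarith))
  · exact sub_lt_sub_right (hG (by linarith)) _
  · have : G (t + u) < G (u + 2 * π) := hG (by linarith)
    rw [hper] at this
    linarith
  · rw [← Circle.exp_add, hγ, hγ, ← Circle.exp_add, sub_add_cancel]
  · rw [← Circle.exp_add, hγ, hγ, ← Circle.exp_add, sub_add_cancel]

variable {d : ℕ}

theorem mem_ccwArc_of_sideLift (hd : 2 ≤ d) {γ : Circle → Circle} {u v : ℝ}
    (hγ : ∀ s, γ (Circle.exp (u + s)) = Circle.exp (v + sideLift d s))
    {a b z : Circle} (hz : z ∈ ccwArc a b) : γ z ∈ ccwArc (γ a) (γ b) := by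
  refine mem_ccwArc_of_lift (G := fun x => v + sideLift d (x - u)) (fun x y hxy => ?_)
    (fun x => ?_) (fun x => ?_) hz
  · exact add_lt_add_right (strictMono_sideLift hd (sub_lt_sub_right hxy u)) v
  · have : sideLift d (x - u + 2 * π) = sideLift d (x - u) + 2 * π := blaschkeLift_add_two_pi _
    rw [add_sub_right_comm, this, add_assoc]
  · rw [← hγ, add_sub_cancel]

/-- Elements of the group preserve counter-clockwise arcs. -/
theorem mem_ccwArc_iff_of_mem_group (hd : 2 ≤ d) {γ : Circle ≃ₜ Circle}
    (hγ : γ ∈ puncturedSphereGroup hd) (a b z : Circle) :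
    γ z ∈ ccwArc (γ a) (γ b) ↔ z ∈ ccwArc a b := by
  induction hγ using Subgroup.closure_induction generalizing a b z with
  | mem γ h =>
    obtain ⟨j, rfl⟩ := h
    refine ⟨fun h => ?_, mem_ccwArc_of_sideLift hd (sideGenerator_exp hd j)⟩
    have h1 := mem_ccwArc_of_sideLift hd (sideGenerator_inv_exp hd j) h
    have h2 : ∀ w, (sideGenerator hd j)⁻¹ (sideGenerator hd j w) = w :=
      (sideGenerator hd j).symm_apply_apply
    rwa [h2, h2, h2] at h1
  | one => exact Iff.rfl
  | mul γ₁ γ₂ _ _ h1 h2 => exact (h1 _ _ _).trans (h2 _ _ _)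
  | inv γ _ h =>
    have h2 : ∀ w, γ (γ⁻¹ w) = w := γ.apply_symm_apply
    rw [← h, h2, h2, h2]

/-- Inversion scales the distance of `x` and `y` by `r ^ 2 / (|x - c| |y - c|)`, and the centre `c`
is at distance at least `‖c‖ - 1 > 0` from the unit circle. -/
theorem lipschitz_hypReflection (hd : 2 ≤ d) (j : Fin d) :
    ∃ K, LipschitzWith K (hypReflection (sideCenter d j) (sideRadius d) (sideRadius_ne_zero hd)
      (norm_sideCenter_sq hd j)) := by
  have hr : 0 < sideRadius d ^ 2 := by
    have := sideRadius_ne_zero hd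
    positivity
  have hnorm := norm_sideCenter_sq hd j
  have hm : 0 < ‖sideCenter d j‖ - 1 := by
    nlinarith [norm_nonneg (sideCenter d j)]
  set m := ‖sideCenter d j‖ - 1 with hmdef
  have hdist : ∀ z : Circle, m ≤ dist (z : ℂ) (sideCenter d j) := fun z => by
    have := norm_sub_norm_le (sideCenter d j) (z : ℂ)
    rw [Circle.norm_coe] at this
    rwa [dist_comm, dist_eq_norm]
  have hne : ∀ z : Circle, (z : ℂ) ≠ sideCenter d j := fun z h => by
    have := hdist z
    rw [h, dist_self] at this
    linarith
  refine ⟨(sideRadius d ^ 2 / (m * m)).toNNReal, LipschitzWith.of_dist_le_mul fun x y => ?_⟩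
  rw [Real.coe_toNNReal _ (by positivity)]
  change dist (EuclideanGeometry.inversion (sideCenter d j) (sideRadius d) (x : ℂ))
    (EuclideanGeometry.inversion (sideCenter d j) (sideRadius d) (y : ℂ)) ≤ _ * dist (x : ℂ) (y : ℂ)
  rw [EuclideanGeometry.dist_inversion_inversion (hne x) (hne y)]
  gcongr
  · exact hdist x
  · exact hdist y

theorem lipschitz_inv_circle : LipschitzWith 1 (Homeomorph.inv Circle) := by
  refine LipschitzWith.of_dist_le_mul fun x y => ?_
  rw [NNReal.coe_one, one_mul]
  change dist ((x⁻¹ : Circle) : ℂ) ((y⁻¹ : Circle) : ℂ) ≤ dist (x : ℂ) (y : ℂ)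
  rw [Circle.coe_inv_eq_conj, Circle.coe_inv_eq_conj, dist_eq_norm, ← map_sub, Complex.norm_conj,
    dist_eq_norm]

/-- Elements of the group are bi-Lipschitz. -/
theorem exists_lipschitzWith_of_mem_group (hd : 2 ≤ d) {γ : Circle ≃ₜ Circle}
    (hγ : γ ∈ puncturedSphereGroup hd) :
    (∃ K, LipschitzWith K γ) ∧ ∃ K, LipschitzWith K (γ⁻¹ : Circle ≃ₜ Circle) := by
  induction hγ using Subgroup.closure_induction with
  | mem γ h =>
    obtain ⟨j, rfl⟩ := h
    obtain ⟨K, hK⟩ := lipschitz_hypReflection hd j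
    exact ⟨⟨_, lipschitz_inv_circle.comp hK⟩, ⟨_, hK.comp lipschitz_inv_circle⟩⟩
  | one => exact ⟨⟨1, LipschitzWith.id⟩, ⟨1, LipschitzWith.id⟩⟩
  | mul γ₁ γ₂ _ _ h1 h2 =>
    obtain ⟨⟨K1, hK1⟩, ⟨L1, hL1⟩⟩ := h1
    obtain ⟨⟨K2, hK2⟩, ⟨L2, hL2⟩⟩ := h2
    refine ⟨⟨_, hK1.comp hK2⟩, ⟨L2 * L1, ?_⟩⟩
    rw [mul_inv_rev]
    exact hL2.comp hL1
  | inv γ _ h => exact ⟨h.2, by rw [inv_inv]; exact h.1⟩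

/-- A homeomorphism carries Borel sets of full measure to such sets for the image measure, and a
Lipschitz map does not raise their dimension. -/
theorem measureHausdorffDim_map_le {X Y : Type*} [EMetricSpace X] [MeasurableSpace X] [BorelSpace X]
    [EMetricSpace Y] [MeasurableSpace Y] [BorelSpace Y] (γ : X ≃ₜ Y) {K : NNReal}
    (hK : LipschitzWith K γ) (μ : Measure X) :
    measureHausdorffDim (μ.map γ) ≤ measureHausdorffDim μ := by
  refine le_iInf fun S => le_iInf fun hS => le_iInf fun h1 => ?_
  have hmeas : MeasurableSet (γ '' S) := γ.measurableEmbedding.measurableSet_image.2 hS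
  have hone : (μ.map γ) (γ '' S) = 1 := by
    rw [γ.measurableEmbedding.map_apply, Set.preimage_image_eq _ γ.injective, h1]
  refine le_trans ?_ (hK.dimH_image_le S)
  exact iInf_le_of_le (γ '' S) (iInf_le_of_le hmeas (iInf_le_of_le hone le_rfl))

theorem map_inv_map (γ : Circle ≃ₜ Circle) (μ : Measure Circle) :
    (μ.map γ).map (γ⁻¹ : Circle ≃ₜ Circle) = μ := by
  rw [Measure.map_map (γ⁻¹ : Circle ≃ₜ Circle).measurable γ.measurable]
  have : (γ⁻¹ : Circle ≃ₜ Circle) ∘ γ = id := funext γ.symm_apply_apply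
  rw [this, Measure.map_id]

theorem measureHausdorffDim_map_of_mem_group (hd : 2 ≤ d) {γ : Circle ≃ₜ Circle}
    (hγ : γ ∈ puncturedSphereGroup hd) (μ : Measure Circle) :
    measureHausdorffDim (μ.map γ) = measureHausdorffDim μ := by
  obtain ⟨⟨K, hK⟩, ⟨L, hL⟩⟩ := exists_lipschitzWith_of_mem_group hd hγ
  refine le_antisymm (measureHausdorffDim_map_le γ hK μ) ?_
  have := measureHausdorffDim_map_le γ⁻¹ hL (μ.map γ)
  rwa [map_inv_map] at this

/-- A homeomorphism that locally agrees with `A` or with an inverse branch of `A` preserves null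
sets of an `A`-invariant measure for which `A` maps null sets to null sets. -/
theorem map_absolutelyContinuous_of_dichotomy {X : Type*} [TopologicalSpace X] [T2Space X]
    [MeasurableSpace X] [BorelSpace X] {ν : Measure X} {A : X → X} (hc : Continuous A)
    (hinv : MeasurePreserving A ν ν) (hnull : ∀ E, ν E = 0 → ν (A ⁻¹' (A '' E)) = 0)
    (p : X ≃ₜ X) (hp : ∀ x, A x = p x ∨ A (p x) = x) : ν.map p ≪ ν := by
  refine Measure.AbsolutelyContinuous.mk fun E hE h0 => ?_
  rw [Measure.map_apply p.measurable hE]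
  -- The part of `p ⁻¹' E` on which `A` undoes `p`; it lies in `A '' E`. Invariance is applied to
  -- `S` because `S` is visibly Borel, while `A '' E` is not.
  set S := p ⁻¹' (E ∩ {y | A y = p.symm y}) with hS
  have hSm : MeasurableSet S :=
    p.measurable (hE.inter (isClosed_eq hc p.symm.continuous).measurableSet)
  have hS0 : ν S = 0 := by
    rw [← hinv.measure_preimage hSm.nullMeasurableSet]
    refine measure_mono_null (Set.preimage_mono ?_) (hnull E h0)
    rintro x ⟨hx1, hx2⟩
    replace hx2 : A (p x) = p.symm (p x) := hx2
    exact ⟨p x, hx1, by rw [hx2, p.symm_apply_apply]⟩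
  have hA0 : ν (A ⁻¹' E) = 0 := by rw [hinv.measure_preimage hE.nullMeasurableSet, h0]
  refine measure_mono_null (fun x hx => ?_) (measure_union_null hA0 hS0)
  rcases hp x with h | h
  · left
    rw [Set.mem_preimage, h]
    exact hx
  · right
    refine ⟨hx, ?_⟩
    change A (p x) = p.symm (p x)
    rw [h, p.symm_apply_apply]

/-- The Bowen-Series map of the preferred domain has a unique measure of maximal entropy, and this
measure is quasi-invariant under the side pairings. -/
theorem exists_isMME_bowenSeriesMap (hd : 2 ≤ d) :
    ∃ ν : Measure Circle, (∀ μ, IsMME (preferredDomain hd).bowenSeriesMap μ ↔ μ = ν) ∧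
      ∀ k, ν.map ((preferredDomain hd).pairing k) ≪ ν := by
  have : NeZero (2 * d - 1) := ⟨by omega⟩
  have hN : 2 ≤ 2 * d - 1 := by omega
  obtain ⟨Φ, hΦ⟩ := exists_conjugacy_bowenSeriesMap hd
  set A := (preferredDomain hd).bowenSeriesMap with hA
  have hΦ' : Function.Semiconj Φ.symm A (circleMul (2 * d - 1)) := fun y => by
    apply Φ.injective
    rw [Φ.apply_symm_apply, hΦ.eq, Φ.apply_symm_apply]
  have hMME : IsMME A ((volume : Measure UnitAddCircle).map Φ) :=
    ((isMME_circleMul_iff hN).2 rfl).map_homeomorph Φ hΦ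
  refine ⟨(volume : Measure UnitAddCircle).map Φ, fun μ => ⟨fun h => ?_, ?_⟩, fun k => ?_⟩
  · rw [← (isMME_circleMul_iff hN).1 (h.map_homeomorph Φ.symm hΦ'),
      Measure.map_map Φ.measurable Φ.symm.measurable]
    simp
  · rintro rfl
    exact hMME
  · refine map_absolutelyContinuous_of_dichotomy (A := A) ?_ hMME.measurePreserving ?_ _
      (bowenSeriesMap_dichotomy hd k)
    · have : A = Φ ∘ circleMul (2 * d - 1) ∘ Φ.symm := by
        funext y
        simp only [Function.comp]
        rw [hΦ.eq, Φ.apply_symm_apply]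
      rw [this]
      exact Φ.continuous.comp ((continuous_nsmul (2 * d - 1)).comp Φ.symm.continuous)
    · intro E hE
      rw [Φ.measurableEmbedding.map_apply] at hE ⊢
      refine measure_mono_null ?_ (volume_preimage_image_circleMul hN hE)
      rintro x ⟨y, hy, hyx⟩
      refine ⟨Φ.symm y, ?_, ?_⟩
      · change Φ (Φ.symm y) ∈ E
        rwa [Φ.apply_symm_apply]
      · rw [← hΦ'.eq, hyx, hΦ'.eq, Φ.symm_apply_apply]

theorem absolutelyContinuous_of_mem_group (hd : 2 ≤ d) {ν : Measure Circle}
    (hν : ∀ k, ν.map ((preferredDomain hd).pairing k) ≪ ν) {γ : Circle ≃ₜ Circle}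
    (hγ : γ ∈ puncturedSphereGroup hd) : ν ≪ ν.map γ ∧ ν.map γ ≪ ν := by
  -- Keeping `γ` and `γ⁻¹` together makes the induction symmetric; the reverse relation `ν ≪ ν.map
  -- γ` follows by pushing the second half forward by `γ`.
  have key : ν.map γ ≪ ν ∧ ν.map (γ⁻¹ : Circle ≃ₜ Circle) ≪ ν := by
    induction hγ using Subgroup.closure_induction with
    | mem γ h =>
      obtain ⟨j, rfl⟩ := h
      have hj : (preferredDomain hd).pairing ⟨j, by omega⟩ = sideGenerator hd j := dif_pos j.2
      refine ⟨hj ▸ hν ⟨j, by omega⟩, ?_⟩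
      rw [← hj, ← pairing_rev]
      exact hν _
    | one =>
      have h1 : ν.map (1 : Circle ≃ₜ Circle) = ν := Measure.map_id
      rw [inv_one, h1]
      exact ⟨Measure.AbsolutelyContinuous.rfl, Measure.AbsolutelyContinuous.rfl⟩
    | mul γ₁ γ₂ _ _ h1 h2 =>
      have hmul : ∀ δ₁ δ₂ : Circle ≃ₜ Circle, ν.map δ₁ ≪ ν → ν.map δ₂ ≪ ν →
          ν.map (δ₁ * δ₂ : Circle ≃ₜ Circle) ≪ ν := fun δ₁ δ₂ h1 h2 => by
        have : ν.map (δ₁ * δ₂ : Circle ≃ₜ Circle) = (ν.map δ₂).map δ₁ :=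
          (Measure.map_map δ₁.measurable δ₂.measurable).symm
        rw [this]
        exact (h2.map δ₁.measurable).trans h1
      rw [mul_inv_rev]
      exact ⟨hmul _ _ h1.1 h2.1, hmul _ _ h2.2 h1.2⟩
    | inv γ _ h => exact ⟨h.2, by rw [inv_inv]; exact h.1⟩
  refine ⟨?_, key.1⟩
  have := key.2.map γ.measurable
  have h2 := map_inv_map γ⁻¹ ν
  rw [inv_inv] at h2
  rwa [h2] at this

/-- `γ` conjugates the two Bowen-Series maps because it preserves half-open arcs, so it transports
measures of maximal entropy in both directions. -/
theorem isMME_translate_iff (hd : 2 ≤ d) {ν : Measure Circle}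
    (hν : ∀ μ, IsMME (preferredDomain hd).bowenSeriesMap μ ↔ μ = ν) {γ : Circle ≃ₜ Circle}
    (hγ : γ ∈ puncturedSphereGroup hd) (μ : Measure Circle) :
    IsMME ((preferredDomain hd).translate γ).bowenSeriesMap μ ↔ μ = ν.map γ := by
  have h1 : Function.Semiconj γ (preferredDomain hd).bowenSeriesMap
      ((preferredDomain hd).translate γ).bowenSeriesMap := fun z =>
    (MarkedIdealPolygon.bowenSeriesMap_translate (arc_preferredDomain_unique hd)
      (arc_preferredDomain_cover hd) (mem_ccwArc_iff_of_mem_group hd hγ) z).symm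
  have h2 : Function.Semiconj γ.symm ((preferredDomain hd).translate γ).bowenSeriesMap
      (preferredDomain hd).bowenSeriesMap := fun z => by
    apply γ.injective
    rw [γ.apply_symm_apply, h1.eq, γ.apply_symm_apply]
  constructor
  · intro h
    rw [← (hν _).1 (h.map_homeomorph γ.symm h2), Measure.map_map γ.measurable γ.symm.measurable]
    simp
  · rintro rfl
    exact ((hν ν).2 rfl).map_homeomorph γ h1

end GroupAction

theorem mainTheorem5 {d : ℕ} (hd : 2 ≤ d) :
    -- the Bowen-Series map has a unique measure of maximal entropy
    (∃! ν : Measure Circle, IsMME (preferredDomain hd).bowenSeriesMap ν) ∧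
    -- its measure class is invariant under the group
    (∀ ν : Measure Circle, IsMME (preferredDomain hd).bowenSeriesMap ν →
      ∀ γ ∈ puncturedSphereGroup hd, ν ≪ ν.map γ ∧ ν.map γ ≪ ν) ∧
    -- the Bowen-Series map of each translated fundamental domain has a unique MME as well
    (∀ γ ∈ puncturedSphereGroup hd,
      ∃! ν : Measure Circle, IsMME ((preferredDomain hd).translate γ).bowenSeriesMap ν) ∧
    -- the measures of maximal entropy for all translates are mutually absolutely continuous and
    -- have the same Hausdorff dimension
    (∀ γ₁ ∈ puncturedSphereGroup hd, ∀ γ₂ ∈ puncturedSphereGroup hd, ∀ ν₁ ν₂ : Measure Circle,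
      IsMME ((preferredDomain hd).translate γ₁).bowenSeriesMap ν₁ →
      IsMME ((preferredDomain hd).translate γ₂).bowenSeriesMap ν₂ →
      (ν₁ ≪ ν₂ ∧ ν₂ ≪ ν₁) ∧ measureHausdorffDim ν₁ = measureHausdorffDim ν₂) := by
  obtain ⟨ν, hν, hq⟩ := exists_isMME_bowenSeriesMap hd
  refine ⟨⟨ν, (hν ν).2 rfl, fun μ hμ => (hν μ).1 hμ⟩, ?_, ?_, ?_⟩
  · intro μ hμ γ hγ
    obtain rfl := (hν μ).1 hμ
    exact absolutelyContinuous_of_mem_group hd hq hγ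
  · intro γ hγ
    exact ⟨ν.map γ, (isMME_translate_iff hd hν hγ _).2 rfl,
      fun μ hμ => (isMME_translate_iff hd hν hγ μ).1 hμ⟩
  · intro γ₁ hγ₁ γ₂ hγ₂ ν₁ ν₂ h1 h2
    rw [(isMME_translate_iff hd hν hγ₁ ν₁).1 h1, (isMME_translate_iff hd hν hγ₂ ν₂).1 h2,
      measureHausdorffDim_map_of_mem_group hd hγ₁, measureHausdorffDim_map_of_mem_group hd hγ₂]
    have a1 := absolutelyContinuous_of_mem_group hd hq hγ₁
    have a2 := absolutelyContinuous_of_mem_group hd hq hγ₂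
    exact ⟨⟨a1.2.trans a2.1, a2.2.trans a1.1⟩, rfl⟩
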